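/- **Conventions.** Write a quaternion as $q=z_1+z_2\mathbf j$ with $z_1=x_1+\mathbf i y_1$, $z_2=x_2+\mathbf i y_2$. On an open set $O\subset\mathbb H$, a function $f:O\to\mathbb H$ is *hyperholomorphic* if it is $C^\infty$ and $\mathcal Df=\frac12\big(\frac{\partial}{\partial\bar z_1}+\mathbf j\frac{\partial}{\partial\bar z_2}\big)f=0$, where $\frac{\partial f}{\partial\bar z_l}=\frac12\big(\frac{\partial f}{\partial x_l}+\mathbf i\frac{\partial f}{\partial y_l}\big)$ (left multiplication). A function $f$ on an open set $U\subset\mathbb H$ is *weakly hypermeromorphic* if every point of $U$ has an open neighbourhood $N\subset U$ and a closed set $T$, with $N\cap T$ contained in a finite union of $C^\infty$ hypersurfaces $\{\varphi=0,\ d\varphi\neq0\}$ ($\varphi:N\to\mathbb R$ smooth), such that $f$ is hyperholomorphic on $N\setminus T$ and $f^{-1}$ is hyperholomorphic on $\{q\in N\setminus T: f(q)\ne 0\}$ (the values of $f$ on $T$ are irrelevant). Fix a *sheaf of hypermeromorphic functions* $\mathcal M$ on $\mathbb H$: a sheaf of (unital) rings of weakly hypermeromorphic functions, maximal for inclusion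 among such sheaves of rings. Let $X$, $Y$ be Hausdorff spaces, each with an atlas of $\mathbb H$-valued charts $h:U\to h(U)\subset\mathbb H$ (homeomorphisms between open sets; no condition on the transition functions is needed). For $W$ open in $X$, a function $g:W\to\mathbb H$ is *hypermeromorphic* if it is continuous and $g\circ h^{-1}\in\mathcal M(h(U\cap W))$ for every chart $(h,U)$ of the atlas; it is *pseudoholomorphic* if moreover every $g\circ h^{-1}$ is hyperholomorphic on all of $h(U\cap W)$ (no poles). A *morphism* $Y\to X$ is a continuous map that pulls pseudoholomorphic functions on open sets of $X$ back to pseudoholomorphic functions; a homeomorphism between open sets of $Y$ and $X$ is *bi-pseudoholomorphic* if it and its inverse both do so. A point $x\in X$ is a *regular value* of $\Pi:Y\to X$ (for $n$ sheets) if it has an open neighbourhood $U$ such that $\Pi^{-1}(U)$ is a disjoint union of $n$ open sets $V_1,\dots,V_n$ with each $\Pi|_{V_j}:V_j\to U$ a bi-pseudoholomorphic homeomorphism; otherwise $x$ is a *critical value*. $\Pi$ is an *$n$-sheeted ramified pseudoholomorphic covering* if it is a proper morphism with finite fibres whose set of critical values is closed and discrete. **Theorem 6.5.** Let $\Pi:Y\to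 X$ be an $n$-sheeted ramified pseudoholomorphic covering ($Y$ not necessarily connected), $A\subset X$ a closed discrete set containing all critical values of $\Pi$, and $B=\Pi^{-1}(A)$. Let $f$ be a pseudoholomorphic (resp. hypermeromorphic) function on $Y\setminus B$, and let $c_1,\dots,c_n:X\setminus A\to\mathbb H$ be elementary symmetric functions of $f$ with respect to $\Pi$: every point of $X\setminus A$ has an open neighbourhood $U\subset X\setminus A$ over which $\Pi$ has sheets $V_1,\dots,V_n$ as above, so numbered that, with $f_j=f\circ(\Pi|_{V_j})^{-1}$ and $T$ an indeterminate commuting with $\mathbb H$, $$(T-f_1)(T-f_2)\cdots(T-f_n)=T^n+c_1T^{n-1}+\cdots+c_n\qquad\text{at every point of }U.$$ Then $c_1,\dots,c_n$ are pseudoholomorphic (resp. hypermeromorphic) on $X\setminus A$, and the following are equivalent: (i) $f$ has a pseudoholomorphic (resp. hypermeromorphic) extension to $Y$; (ii) for every $j=1,\dots,n$, $c_j$ has a pseudoholomorphic (resp. hypermeromorphic) extension to $X$. -/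

import Mathlib

open Set TopologicalSpace
open scoped Quaternion ContDiff

namespace Hyper

/-! ### Hyperholomorphic functions on open sets of `ℍ`

A quaternion is written `q = z₁ + z₂ j` with `z₁ = x₁ + i y₁`, `z₂ = x₂ + i y₂`, that is
`q = x₁ + y₁ i + x₂ j + y₂ k`. -/

/-- The quaternion unit `i`. -/
def qi : ℍ[ℝ] := ⟨0, 1, 0, 0⟩

/-- The quaternion unit `j`. -/
def qj : ℍ[ℝ] := ⟨0, 0, 1, 0⟩

/-- The quaternion unit `k = i j`. -/
def qk : ℍ[ℝ] := ⟨0, 0, 0, 1⟩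

/-- `∂f/∂z̄₁ = (∂f/∂x₁ + i ∂f/∂y₁) / 2`. -/
noncomputable def dbar₁ (f : ℍ[ℝ] → ℍ[ℝ]) (q : ℍ[ℝ]) : ℍ[ℝ] :=
  (2⁻¹ : ℝ) • (fderiv ℝ f q 1 + qi * fderiv ℝ f q qi)

/-- `∂f/∂z̄₂ = (∂f/∂x₂ + i ∂f/∂y₂) / 2`. -/
noncomputable def dbar₂ (f : ℍ[ℝ] → ℍ[ℝ]) (q : ℍ[ℝ]) : ℍ[ℝ] :=
  (2⁻¹ : ℝ) • (fderiv ℝ f q qj + qi * fderiv ℝ f q qk)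

/-- The modified Cauchy-Fueter operator `𝒟 = (∂/∂z̄₁ + j ∂/∂z̄₂) / 2`. -/
noncomputable def cauchyFueter (f : ℍ[ℝ] → ℍ[ℝ]) (q : ℍ[ℝ]) : ℍ[ℝ] :=
  (2⁻¹ : ℝ) • (dbar₁ f q + qj * dbar₂ f q)

/-- `f` is hyperholomorphic on the open set `O`: it is `C^∞` there and `𝒟 f = 0`. -/
def HyperholomorphicOn (f : ℍ[ℝ] → ℍ[ℝ]) (O : Set ℍ[ℝ]) : Prop :=
  ContDiffOn ℝ ∞ f O ∧ ∀ q ∈ O, cauchyFueter f q = 0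

/-- The `C^∞` hypersurface cut out by `φ`: the zeros of `φ` at which `dφ ≠ 0`. -/
def hypersurface (φ : ℍ[ℝ] → ℝ) : Set ℍ[ℝ] :=
  {q | φ q = 0 ∧ fderiv ℝ φ q ≠ 0}

/-- `f` is an almost everywhere defined hyperholomorphic function on `U` whose inverse is
hyperholomorphic almost everywhere.  Near each point of `U` there is a closed exceptional set `T`
contained in finitely many `C^∞` hypersurfaces (so that, over `U`, one removes a locally finite
family of hypersurfaces), off which `f` is hyperholomorphic and `f⁻¹` is hyperholomorphic wherever
it is defined.  The values of `f` on the exceptional set play no role. -/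
def WeaklyHypermeromorphicOn (f : ℍ[ℝ] → ℍ[ℝ]) (U : Set ℍ[ℝ]) : Prop :=
  ∀ q ∈ U, ∃ (N T : Set ℍ[ℝ]) (m : ℕ) (φ : Fin m → ℍ[ℝ] → ℝ),
    IsOpen N ∧ q ∈ N ∧ N ⊆ U ∧ IsClosed T ∧
    (∀ i, ContDiffOn ℝ ∞ (φ i) N) ∧
    N ∩ T ⊆ ⋃ i, hypersurface (φ i) ∧
    HyperholomorphicOn f (N \ T) ∧
    HyperholomorphicOn (fun p => (f p)⁻¹) ((N \ T) ∩ {p | f p ≠ 0})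

/-- A sheaf of rings (on the open sets of `ℍ`) of weakly hypermeromorphic functions; in particular
sums and products of its sections are again weakly hypermeromorphic. -/
structure IsRingSheaf (M : Opens ℍ[ℝ] → Subring (ℍ[ℝ] → ℍ[ℝ])) : Prop where
  weaklyHypermeromorphic : ∀ (U : Opens ℍ[ℝ]), ∀ f ∈ M U, WeaklyHypermeromorphicOn f U
  restrict : ∀ (U V : Opens ℍ[ℝ]), V ≤ U → ∀ f ∈ M U, f ∈ M V
  isLocal : ∀ (U : Opens ℍ[ℝ]) (f : ℍ[ℝ] → ℍ[ℝ]),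
    (∀ q ∈ U, ∃ V : Opens ℍ[ℝ], q ∈ V ∧ V ≤ U ∧ f ∈ M V) → f ∈ M U

/-- `M` is a sheaf of hypermeromorphic functions: a largest possible sheaf of weakly
hypermeromorphic functions in which sums and products can be formed. -/
def IsHypermeromorphicSheaf (M : Opens ℍ[ℝ] → Subring (ℍ[ℝ] → ℍ[ℝ])) : Prop :=
  Maximal IsRingSheaf M

/-! ### Functions on a 4-manifold with an atlas of `ℍ`-valued charts -/

section Functions

variable {X : Type*} [TopologicalSpace X]

/-- The open subset `h(W ∩ dom h)` of `ℍ`, for a chart `h` and an open set `W`. -/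
def chartImage (h : OpenPartialHomeomorph X ℍ[ℝ]) (W : Opens X) : Opens ℍ[ℝ] :=
  ⟨h.target ∩ h.symm ⁻¹' W, h.isOpen_inter_preimage_symm W.isOpen⟩

variable [ChartedSpace ℍ[ℝ] X]

/-- `g` is a hypermeromorphic function on the open set `W`: it is continuous, and in every chart it
is hypermeromorphic. -/
def HypermeromorphicOn (M : Opens ℍ[ℝ] → Subring (ℍ[ℝ] → ℍ[ℝ])) (g : X → ℍ[ℝ])
    (W : Opens X) : Prop :=
  ContinuousOn g W ∧ ∀ h ∈ atlas ℍ[ℝ] X, g ∘ h.symm ∈ M (chartImage h W)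

/-- `g` is a pseudoholomorphic function on the open set `W`: it is continuous, and in every chart it
is hypermeromorphic without poles, i.e. hyperholomorphic at every point. -/
def PseudoholomorphicOn (M : Opens ℍ[ℝ] → Subring (ℍ[ℝ] → ℍ[ℝ])) (g : X → ℍ[ℝ])
    (W : Opens X) : Prop :=
  ContinuousOn g W ∧ ∀ h ∈ atlas ℍ[ℝ] X,
    g ∘ h.symm ∈ M (chartImage h W) ∧ HyperholomorphicOn (g ∘ h.symm) (chartImage h W)

end Functions

/-! ### Ramified coverings and elementary symmetric functions -/

section Coverings

variable {X Y : Type*} [TopologicalSpace X] [TopologicalSpace Y]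
  [ChartedSpace ℍ[ℝ] X] [ChartedSpace ℍ[ℝ] Y]

/-- `p` is a morphism for the sheaves of pseudoholomorphic functions: it is continuous and pulls
pseudoholomorphic functions back to pseudoholomorphic functions. -/
def IsMorphism (M : Opens ℍ[ℝ] → Subring (ℍ[ℝ] → ℍ[ℝ])) (p : Y → X) : Prop :=
  ∃ hp : Continuous p, ∀ (W : Opens X) (g : X → ℍ[ℝ]),
    PseudoholomorphicOn M g W → PseudoholomorphicOn M (g ∘ p) (Opens.comap ⟨p, hp⟩ W)

/-- The homeomorphism `e` between open sets of `Y` and `X` is bi-pseudoholomorphic: it is an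
isomorphism for the sheaves of pseudoholomorphic functions. -/
def IsBiPseudoholomorphic (M : Opens ℍ[ℝ] → Subring (ℍ[ℝ] → ℍ[ℝ]))
    (e : OpenPartialHomeomorph Y X) : Prop :=
  (∀ (W : Opens X) (g : X → ℍ[ℝ]), PseudoholomorphicOn M g W →
    PseudoholomorphicOn M (g ∘ e) ⟨e.source ∩ e ⁻¹' W, e.isOpen_inter_preimage W.isOpen⟩) ∧
  (∀ (W : Opens Y) (g : Y → ℍ[ℝ]), PseudoholomorphicOn M g W →
    PseudoholomorphicOn M (g ∘ e.symm)
      ⟨e.target ∩ e.symm ⁻¹' W, e.isOpen_inter_preimage_symm W.isOpen⟩)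

/-- The maps `e j : V j → U` are the `n` sheets of `p` over `U`: `p⁻¹(U)` is the disjoint union of
the open sets `V j`, and each `p|V j : V j → U` is the bi-pseudoholomorphic map `e j`. -/
structure AreSheets (M : Opens ℍ[ℝ] → Subring (ℍ[ℝ] → ℍ[ℝ])) (p : Y → X) {n : ℕ} (U : Opens X)
    (e : Fin n → OpenPartialHomeomorph Y X) : Prop where
  target_eq : ∀ j, (e j).target = U
  eqOn : ∀ j, EqOn (e j) p (e j).source
  disjoint : Pairwise fun j l => Disjoint (e j).source (e l).source
  iUnion_eq : ⋃ j, (e j).source = p ⁻¹' U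
  biPseudoholomorphic : ∀ j, IsBiPseudoholomorphic M (e j)

/-- The critical values of `p`: the points over no neighbourhood of which `p` is an unramified
pseudoholomorphic covering with `n` sheets. -/
def criticalValues (M : Opens ℍ[ℝ] → Subring (ℍ[ℝ] → ℍ[ℝ])) (p : Y → X) (n : ℕ) : Set X :=
  {x | ¬ ∃ (U : Opens X) (e : Fin n → OpenPartialHomeomorph Y X), x ∈ U ∧ AreSheets M p U e}

/-- `p : Y → X` is a ramified pseudoholomorphic covering with `n` sheets: a proper morphism with
finite fibres, which is an unramified pseudoholomorphic covering with `n` sheets outside a closed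
discrete set of critical values. -/
structure IsRamifiedCovering (M : Opens ℍ[ℝ] → Subring (ℍ[ℝ] → ℍ[ℝ])) (p : Y → X) (n : ℕ) :
    Prop where
  isMorphism : IsMorphism M p
  isProperMap : IsProperMap p
  finite_fiber : ∀ x, (p ⁻¹' {x}).Finite
  isClosed_criticalValues : IsClosed (criticalValues M p n)
  isDiscrete_criticalValues : IsDiscrete (criticalValues M p n)

/-- `c 0, …, c (n - 1)` (usually numbered `c₁, …, cₙ`) are the elementary symmetric functions of `f`
on the open set `W`, with respect to `p`: around each point of `W`, for a numbering `e` of the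
sheets and `f_j = f ∘ (e j)⁻¹`,
`(T - f_1) ⋯ (T - f_n) = T ^ n + c₁ T ^ (n - 1) + ⋯ + cₙ`, where `T` commutes with quaternions. -/
def IsElementarySymmetric (M : Opens ℍ[ℝ] → Subring (ℍ[ℝ] → ℍ[ℝ])) (p : Y → X) {n : ℕ}
    (f : Y → ℍ[ℝ]) (c : Fin n → X → ℍ[ℝ]) (W : Opens X) : Prop :=
  ∀ x₀ ∈ W, ∃ (U : Opens X) (e : Fin n → OpenPartialHomeomorph Y X),
    x₀ ∈ U ∧ U ≤ W ∧ AreSheets M p U e ∧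
    ∀ x ∈ U, (List.ofFn fun j => (Polynomial.X - Polynomial.C (f ((e j).symm x)) : Polynomial ℍ[ℝ])).prod =
      Polynomial.X ^ n +
        ∑ j : Fin n, Polynomial.C (c j x) * Polynomial.X ^ (n - 1 - (j : ℕ))

end Coverings

end Hyper

namespace Hyper

open MeasureTheory Filter Topology Metric

/-! ### The Cauchy-Fueter operator acting from the left and from the right -/

/-! Sections of `M` may misbehave along hypersurfaces, but the functions of the theorem are also
continuous, and a continuous weakly hypermeromorphic function is hyperholomorphic
(`WeaklyHypermeromorphicOn.hyperholomorphicOn`). Hence the two classes coincide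
(`pseudoholomorphicOn_iff`) and only one statement has to be proved. The `c_j` are noncommutative
polynomial expressions in the `f_j`; since `M` is a sheaf of rings, they are hypermeromorphic off
`A`.

The equivalence then follows from Riemann's removable singularity theorem
(`HypermeromorphicOn.exists_extension`) and two estimates. If `f` extends, properness of `p` and
finiteness of the fibres bound `f` on all sheets near a point of `A`, so the coefficients are
bounded there (`norm_coeff_rootProd_le`). If the `c_j` extend, they are locally bounded, and a
noncommutative Cauchy bound (`exists_forall_norm_le_of_norm_coeff_rootProd_le`) bounds every factor,
hence `f` near `B`.

The analysis is a Weyl lemma: a bounded weak solution of the Cauchy-Fueter equation agrees with a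
smooth function at its points of continuity (`exists_contDiffOn_of_weak`), by means of a fundamental
solution smoothed at the origin. To see that a function hyperholomorphic off a point or a
hypersurface is a weak solution, one multiplies test functions by cutoffs and shows that the error
terms vanish: by scaling for a point, by cancellation and continuity for a hypersurface.

Maximality of `M` puts the extended function back into `M`. The functions that are smooth and
locally equal to sections of `M` off thin sets already form a ring sheaf containing `M`, hence equal
to `M`; a point is thin, so punctures can be filled. -/

/-- The real basis `1, i, j, k` of the quaternions. -/
def unit : Fin 4 → ℍ[ℝ] := ![1, qi, qj, qk]

/-- The coefficients `1, i, j, -k` of the modified Cauchy-Fueter operator. -/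
def coef : Fin 4 → ℍ[ℝ] := ![1, qi, qj, -qk]

/-- The operator `4 𝒟`, acting from the left. -/
noncomputable def fueterL (f : ℍ[ℝ] → ℍ[ℝ]) (q : ℍ[ℝ]) : ℍ[ℝ] :=
  ∑ l, coef l * fderiv ℝ f q (unit l)

/-- The operator `4 𝒟`, acting from the right. -/
noncomputable def fueterR (f : ℍ[ℝ] → ℍ[ℝ]) (q : ℍ[ℝ]) : ℍ[ℝ] :=
  ∑ l, fderiv ℝ f q (unit l) * coef l

lemma qj_mul_qi : qj * qi = -qk := by
  apply Quaternion.ext <;>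
    simp only [Quaternion.re_mul, Quaternion.imI_mul, Quaternion.imJ_mul, Quaternion.imK_mul,
      Quaternion.re_neg, Quaternion.imI_neg, Quaternion.imJ_neg, Quaternion.imK_neg] <;>
    norm_num [qi, qj, qk]

lemma cauchyFueter_eq (f : ℍ[ℝ] → ℍ[ℝ]) (q : ℍ[ℝ]) :
    cauchyFueter f q = (4⁻¹ : ℝ) • fueterL f q := by
  simp only [cauchyFueter, dbar₁, dbar₂, fueterL, coef, unit, Fin.sum_univ_four]
  simp only [Matrix.cons_val]
  rw [mul_smul_comm, mul_add, ← mul_assoc, qj_mul_qi, ← smul_add, smul_smul]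
  norm_num
  abel

lemma cauchyFueter_eq_zero_iff (f : ℍ[ℝ] → ℍ[ℝ]) (q : ℍ[ℝ]) :
    cauchyFueter f q = 0 ↔ fueterL f q = 0 := by
  rw [cauchyFueter_eq]; simp

lemma fueterL_congr {f g : ℍ[ℝ] → ℍ[ℝ]} {q : ℍ[ℝ]} (h : f =ᶠ[𝓝 q] g) :
    fueterL f q = fueterL g q := by
  simp only [fueterL, h.fderiv_eq]

lemma continuousOn_fueterL {f : ℍ[ℝ] → ℍ[ℝ]} {O : Set ℍ[ℝ]} (hO : IsOpen O)
    (hf : ContDiffOn ℝ ∞ f O) : ContinuousOn (fueterL f) O := by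
  have h := hf.continuousOn_fderiv_of_isOpen hO (by simp)
  unfold fueterL
  fun_prop

lemma continuous_fueterR {f : ℍ[ℝ] → ℍ[ℝ]} (hf : ContDiff ℝ ∞ f) : Continuous (fueterR f) := by
  have h := hf.continuous_fderiv (by simp)
  unfold fueterR
  fun_prop

lemma fueterR_eq_zero_of_notMem_tsupport {f : ℍ[ℝ] → ℍ[ℝ]} {q : ℍ[ℝ]} (h : q ∉ tsupport f) :
    fueterR f q = 0 := by
  simp [fueterR, fderiv_of_notMem_tsupport (𝕜 := ℝ) h]

lemma hasCompactSupport_fueterR {f : ℍ[ℝ] → ℍ[ℝ]} (h : HasCompactSupport f) :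
    HasCompactSupport (fueterR f) :=
  h.mono' fun q hq => by
    by_contra hq'
    exact hq (fueterR_eq_zero_of_notMem_tsupport hq')

lemma fueterR_smul {u : ℍ[ℝ] → ℝ} {f : ℍ[ℝ] → ℍ[ℝ]} {q : ℍ[ℝ]} (hu : DifferentiableAt ℝ u q)
    (hf : DifferentiableAt ℝ f q) :
    fueterR (fun y => u y • f y) q =
      u q • fueterR f q + ∑ l, fderiv ℝ u q (unit l) • (f q * coef l) := by
  have h : fderiv ℝ (fun y => u y • f y) q = _ := fderiv_fun_smul hu hf
  simp only [fueterR, h, Finset.smul_sum, ← Finset.sum_add_distrib]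
  refine Finset.sum_congr rfl fun l _ => ?_
  simp [add_mul]

/-! ### Hyperholomorphic functions: elementary properties -/

lemma HyperholomorphicOn.mono {f : ℍ[ℝ] → ℍ[ℝ]} {O O' : Set ℍ[ℝ]} (h : HyperholomorphicOn f O)
    (hO : O' ⊆ O) : HyperholomorphicOn f O' :=
  ⟨h.1.mono hO, fun q hq => h.2 q (hO hq)⟩

lemma HyperholomorphicOn.fueterL_eq_zero {f : ℍ[ℝ] → ℍ[ℝ]} {O : Set ℍ[ℝ]}
    (h : HyperholomorphicOn f O) {q : ℍ[ℝ]} (hq : q ∈ O) : fueterL f q = 0 :=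
  (cauchyFueter_eq_zero_iff f q).1 (h.2 q hq)

lemma HyperholomorphicOn.congr {f g : ℍ[ℝ] → ℍ[ℝ]} {O : Set ℍ[ℝ]} (hO : IsOpen O)
    (h : HyperholomorphicOn f O) (hfg : EqOn g f O) : HyperholomorphicOn g O := by
  refine ⟨h.1.congr hfg, fun q hq => ?_⟩
  rw [cauchyFueter_eq_zero_iff,
    fueterL_congr (hfg.eventuallyEq_of_mem (hO.mem_nhds hq)), h.fueterL_eq_zero hq]

lemma hyperholomorphicOn_of_locally {f : ℍ[ℝ] → ℍ[ℝ]} {O : Set ℍ[ℝ]}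
    (h : ∀ q ∈ O, ∃ V, IsOpen V ∧ q ∈ V ∧ HyperholomorphicOn f V) : HyperholomorphicOn f O := by
  refine ⟨fun q hq => ?_, fun q hq => ?_⟩
  · obtain ⟨V, hV, hqV, hf⟩ := h q hq
    exact (hf.1.contDiffAt (hV.mem_nhds hqV)).contDiffWithinAt
  · obtain ⟨V, hV, hqV, hf⟩ := h q hq
    exact hf.2 q hqV

/-- A smooth function that is hyperholomorphic off a set with empty interior is
hyperholomorphic. -/
lemma hyperholomorphicOn_of_dense {f : ℍ[ℝ] → ℍ[ℝ]} {O S : Set ℍ[ℝ]} (hO : IsOpen O)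
    (hf : ContDiffOn ℝ ∞ f O) (hS : interior S = ∅) (h : ∀ q ∈ O \ S, cauchyFueter f q = 0) :
    HyperholomorphicOn f O := by
  refine ⟨hf, fun q hq => ?_⟩
  rw [cauchyFueter_eq_zero_iff]
  have hc := (continuousOn_fueterL hO hf).continuousAt (hO.mem_nhds hq)
  by_contra hne
  have h1 : ∀ᶠ y in 𝓝 q, y ∈ S := by
    filter_upwards [hc.eventually_ne hne, hO.mem_nhds hq] with y hy hyO
    by_contra hyS
    exact hy ((cauchyFueter_eq_zero_iff f y).1 (h y ⟨hyO, hyS⟩))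
  have h2 : q ∈ interior S := mem_interior_iff_mem_nhds.2 h1
  simp [hS] at h2

/-! ### Integration by parts -/

lemma contDiff_of_tsupport_subset {E F : Type*} [NormedAddCommGroup E] [NormedSpace ℝ E]
    [NormedAddCommGroup F] [NormedSpace ℝ F] {H : E → F} {O : Set E}
    (hO : IsOpen O) {n : WithTop ℕ∞} (hH : ContDiffOn ℝ n H O) (hs : tsupport H ⊆ O) :
    ContDiff ℝ n H := by
  refine contDiff_iff_contDiffAt.2 fun x => ?_
  by_cases hx : x ∈ O
  · exact hH.contDiffAt (hO.mem_nhds hx)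
  · exact contDiffAt_const.congr_of_eventuallyEq
      (notMem_tsupport_iff_eventuallyEq.1 fun h => hx (hs h))

section Integration

variable [MeasurableSpace ℍ[ℝ]] [BorelSpace ℍ[ℝ]] (μ : Measure ℍ[ℝ]) [μ.IsAddHaarMeasure]

lemma integral_fderiv_eq_zero {F : Type*} [NormedAddCommGroup F] [NormedSpace ℝ F]
    {H : ℍ[ℝ] → F} (hH : ContDiff ℝ 1 H)
    (hc : HasCompactSupport H) (v : ℍ[ℝ]) : ∫ x, fderiv ℝ H x v ∂μ = 0 := by
  have h1 : Continuous fun x => fderiv ℝ H x v := by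
    have := hH.continuous_fderiv (by simp)
    fun_prop
  have h2 : HasCompactSupport fun x => fderiv ℝ H x v := hc.fderiv_apply ℝ v
  have := integral_smul_fderiv_eq_neg_fderiv_smul_of_integrable (𝕜 := ℝ) (μ := μ)
    (f := fun _ => 1) (g := H) (v := v) (by simp)
    (by simpa using h1.integrable_of_hasCompactSupport h2)
    (by simpa using hH.continuous.integrable_of_hasCompactSupport hc)
    (by simp) (fun x _ => hH.differentiable (by simp) x)
  simpa using this

/-- The weak form of the Cauchy-Fueter equation. -/
lemma HyperholomorphicOn.integral_fueterR_mul {O : Set ℍ[ℝ]} (hO : IsOpen O)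
    {f : ℍ[ℝ] → ℍ[ℝ]} (hf : HyperholomorphicOn f O) {Ψ : ℍ[ℝ] → ℍ[ℝ]} (hΨ : ContDiff ℝ ∞ Ψ)
    (hc : HasCompactSupport Ψ) (hs : tsupport Ψ ⊆ O) : ∫ x, fueterR Ψ x * f x ∂μ = 0 := by
  set H : Fin 4 → ℍ[ℝ] → ℍ[ℝ] := fun l y => Ψ y * (coef l * f y) with hHdef
  have hsupp : ∀ l, tsupport (H l) ⊆ tsupport Ψ := fun l => tsupport_mul_subset_left
  have hH : ∀ l, ContDiff ℝ ∞ (H l) := fun l =>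
    contDiff_of_tsupport_subset hO (hΨ.contDiffOn.mul (contDiffOn_const.mul hf.1))
      ((hsupp l).trans hs)
  have hHc : ∀ l, HasCompactSupport (H l) := fun l => hc.mul_right
  have hd : ∀ l y v, fderiv ℝ (H l) y v =
      fderiv ℝ Ψ y v * (coef l * f y) + Ψ y * (coef l * fderiv ℝ f y v) := by
    intro l y v
    by_cases hy : y ∈ tsupport Ψ
    · have h1 : DifferentiableAt ℝ f y :=
        (hf.1.contDiffAt (hO.mem_nhds (hs hy))).differentiableAt (by simp)
      have h2 : DifferentiableAt ℝ Ψ y := hΨ.differentiable (by simp) y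
      have h3 := h2.hasFDerivAt.mul' (h1.hasFDerivAt.const_mul (coef l))
      have h4 : fderiv ℝ (H l) y = _ := h3.fderiv
      rw [h4]
      simp [add_comm]
    · rw [fderiv_of_notMem_tsupport (𝕜 := ℝ) (fun h => hy (hsupp l h)),
        fderiv_of_notMem_tsupport (𝕜 := ℝ) hy, image_eq_zero_of_notMem_tsupport hy]
      simp
  have hsum : ∀ y, fueterR Ψ y * f y = ∑ l, fderiv ℝ (H l) y (unit l) := by
    intro y
    have : Ψ y * fueterL f y = 0 := by
      by_cases hy : y ∈ tsupport Ψ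
      · rw [hf.fueterL_eq_zero (hs hy), mul_zero]
      · rw [image_eq_zero_of_notMem_tsupport hy, zero_mul]
    simp only [hd, Finset.sum_add_distrib, ← Finset.mul_sum]
    rw [show (∑ l, coef l * fderiv ℝ f y (unit l)) = fueterL f y from rfl, this, add_zero]
    simp only [fueterR, Finset.sum_mul, mul_assoc]
  simp_rw [hsum]
  rw [integral_finsetSum]
  · exact Finset.sum_eq_zero fun l _ =>
      integral_fderiv_eq_zero μ ((hH l).of_le (by simp)) (hHc l) _
  · intro l _
    have := (hH l).continuous_fderiv (by simp)
    exact Continuous.integrable_of_hasCompactSupport (by fun_prop) ((hHc l).fderiv_apply ℝ _)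

end Integration

/-! ### A regularized fundamental solution of the Cauchy-Fueter equation -/

/-- The linear map `∑ x_l e_l ↦ ∑ x_l (coef l)*`. -/
noncomputable def sharp : ℍ[ℝ] →L[ℝ] ℍ[ℝ] :=
  ∑ l, (innerSL ℝ (unit l)).smulRight (star (coef l))

lemma re_qi : qi.re = 0 := rfl
lemma imI_qi : qi.imI = 1 := rfl
lemma imJ_qi : qi.imJ = 0 := rfl
lemma imK_qi : qi.imK = 0 := rfl
lemma re_qj : qj.re = 0 := rfl
lemma imI_qj : qj.imI = 0 := rfl
lemma imJ_qj : qj.imJ = 1 := rfl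
lemma imK_qj : qj.imK = 0 := rfl
lemma re_qk : qk.re = 0 := rfl
lemma imI_qk : qk.imI = 0 := rfl
lemma imJ_qk : qk.imJ = 0 := rfl
lemma imK_qk : qk.imK = 1 := rfl

attribute [local simp] re_qi imI_qi imJ_qi imK_qi re_qj imI_qj imJ_qj imK_qj re_qk imI_qk imJ_qk
  imK_qk

lemma sharp_apply (z : ℍ[ℝ]) :
    (sharp z).re = z.re ∧ (sharp z).imI = -z.imI ∧ (sharp z).imJ = -z.imJ ∧
      (sharp z).imK = z.imK := by
  simp [sharp, Fin.sum_univ_four, coef, unit, Quaternion.inner_def]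

lemma sum_sharp_unit_mul_coef : ∑ l, sharp (unit l) * coef l = 4 := by
  simp only [Fin.sum_univ_four, coef, unit, Matrix.cons_val]
  rw [show (4 : ℍ[ℝ]) = ((4 : ℝ) : ℍ[ℝ]) by norm_cast]
  apply Quaternion.ext <;> simp [sharp_apply]
  norm_num

/-- `sharp z` is the conjugate of `∑ z_l coef l`, so the sum is a quaternion of norm `‖z‖`
multiplied by its own conjugate. This makes `sharp z / ‖z‖ ^ 4` a solution of the right equation
away from the origin. -/
lemma sum_inner_smul_sharp_mul_coef (z : ℍ[ℝ]) :
    ∑ l, inner ℝ z (unit l) • (sharp z * coef l) = ((‖z‖ ^ 2 : ℝ) : ℍ[ℝ]) := by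
  rw [sq, ← Quaternion.normSq_eq_norm_mul_self, Quaternion.normSq_def']
  generalize ht : z.re ^ 2 + z.imI ^ 2 + z.imJ ^ 2 + z.imK ^ 2 = t
  simp only [Fin.sum_univ_four, coef, unit, Matrix.cons_val, Quaternion.inner_def]
  apply Quaternion.ext
  · simp [sharp_apply]
    linear_combination ht
  all_goals
    simp [sharp_apply]
    ring

/-- A smooth nondecreasing function that vanishes near `0` and equals `1` on `[δ², ∞)`. -/
noncomputable def step (δ s : ℝ) : ℝ := Real.smoothTransition (2 * (s / δ ^ 2) - 1)

lemma contDiff_step (δ : ℝ) : ContDiff ℝ ∞ (step δ) := by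
  unfold step
  exact Real.smoothTransition.contDiff.comp (by fun_prop)

lemma monotone_step (δ : ℝ) : Monotone (step δ) := fun s t h =>
  Real.smoothTransition.monotone (by gcongr)

lemma step_of_le {δ s : ℝ} (hδ : 0 < δ) (h : s ≤ δ ^ 2 / 2) : step δ s = 0 :=
  Real.smoothTransition.zero_of_nonpos (by
    have : s / δ ^ 2 ≤ 1 / 2 := by rw [div_le_iff₀ (by positivity)]; linarith
    linarith)

lemma step_of_ge {δ s : ℝ} (hδ : 0 < δ) (h : δ ^ 2 ≤ s) : step δ s = 1 :=
  Real.smoothTransition.one_of_one_le (by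
    have : 1 ≤ s / δ ^ 2 := by rw [le_div_iff₀ (by positivity)]; linarith
    linarith)

/-- The radial profile of the regularized fundamental solution. -/
noncomputable def profile (δ s : ℝ) : ℝ := step δ s / s ^ 2

lemma profile_eventuallyEq_zero {δ : ℝ} (hδ : 0 < δ) : profile δ =ᶠ[𝓝 0] fun _ => 0 := by
  filter_upwards [Iio_mem_nhds (show (0 : ℝ) < δ ^ 2 / 2 by positivity)] with s hs
  simp [profile, step_of_le hδ (le_of_lt hs)]

lemma contDiff_profile {δ : ℝ} (hδ : 0 < δ) : ContDiff ℝ ∞ (profile δ) := by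
  refine contDiff_iff_contDiffAt.2 fun s => ?_
  rcases eq_or_ne s 0 with rfl | hs
  · exact contDiffAt_const.congr_of_eventuallyEq (profile_eventuallyEq_zero hδ)
  · exact (contDiff_step δ).contDiffAt.div (by fun_prop) (by positivity)

/-- The radial profile of the derivative of the regularized fundamental solution. -/
noncomputable def density (δ s : ℝ) : ℝ := 4 * profile δ s + 2 * s * deriv (profile δ) s

/-- Differentiating `step = s ^ 2 * profile` makes the terms without a derivative of `step` cancel.
So the density inherits the sign of `deriv (step δ)` and vanishes where the step is locally
constant. -/
lemma density_eq {δ s : ℝ} (hδ : 0 < δ) (hs : s ≠ 0) :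
    density δ s = 2 * deriv (step δ) s / s := by
  have h1 : step δ = fun t => t ^ 2 * profile δ t := by
    funext t
    rcases eq_or_ne t 0 with rfl | ht
    · rw [step_of_le hδ (by positivity)]; simp
    · rw [profile]; field_simp
  have h2 : HasDerivAt (profile δ) (deriv (profile δ) s) s :=
    ((contDiff_profile hδ).differentiable (by simp) s).hasDerivAt
  have h3 : HasDerivAt (fun t => t ^ 2 * profile δ t) _ s := (hasDerivAt_pow 2 s).mul h2
  rw [density, h1, h3.deriv]
  field_simp
  ring

lemma density_zero {δ : ℝ} (hδ : 0 < δ) : density δ 0 = 0 := by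
  simp [density, (profile_eventuallyEq_zero hδ).eq_of_nhds]

lemma density_nonneg {δ s : ℝ} (hδ : 0 < δ) (hs : 0 ≤ s) : 0 ≤ density δ s := by
  rcases hs.eq_or_lt with rfl | hs
  · rw [density_zero hδ]
  · rw [density_eq hδ hs.ne']
    have := (monotone_step δ).deriv_nonneg (x := s)
    positivity

lemma density_of_gt {δ s : ℝ} (hδ : 0 < δ) (hs : δ ^ 2 < s) : density δ s = 0 := by
  have hs0 : 0 < s := lt_trans (by positivity) hs
  have : step δ =ᶠ[𝓝 s] fun _ => 1 := by
    filter_upwards [Ioi_mem_nhds hs] with t ht using step_of_ge hδ (le_of_lt ht)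
  rw [density_eq hδ hs0.ne', this.deriv_eq]
  simp

lemma continuous_density {δ : ℝ} (hδ : 0 < δ) : Continuous (density δ) := by
  have h1 := (contDiff_profile hδ).continuous
  have h2 := (contDiff_profile hδ).continuous_deriv (by simp)
  unfold density
  fun_prop

lemma exists_density_ne_zero {δ : ℝ} (hδ : 0 < δ) : ∃ s, 0 < s ∧ density δ s ≠ 0 := by
  have h : δ ^ 2 / 2 < δ ^ 2 := half_lt_self (by positivity)
  obtain ⟨s, hs, hs'⟩ := exists_deriv_eq_slope (step δ) h (contDiff_step δ).continuous.continuousOn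
    ((contDiff_step δ).differentiable (by simp)).differentiableOn
  have hs0 : 0 < s := lt_trans (by positivity) hs.1
  refine ⟨s, hs0, ?_⟩
  rw [density_eq hδ hs0.ne', hs', step_of_ge hδ le_rfl, step_of_le hδ le_rfl]
  have : 0 < δ ^ 2 - δ ^ 2 / 2 := by linarith
  positivity

/-- A fundamental solution of the Cauchy-Fueter equation, smoothed out in the ball of
radius `δ`. -/
noncomputable def kernel (δ : ℝ) (z : ℍ[ℝ]) : ℍ[ℝ] := profile δ (‖z‖ ^ 2) • sharp z

lemma contDiff_kernel {δ : ℝ} (hδ : 0 < δ) : ContDiff ℝ ∞ (kernel δ) :=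
  ((contDiff_profile hδ).comp (contDiff_norm_sq ℝ)).smul sharp.contDiff

lemma kernel_eq {δ r : ℝ} (hδ : 0 < δ) (hr : δ ≤ r) {z : ℍ[ℝ]} (hz : r ≤ ‖z‖) :
    kernel δ z = kernel r z := by
  have hr0 : 0 < r := hδ.trans_le hr
  have h1 : r ^ 2 ≤ ‖z‖ ^ 2 := by gcongr
  have h2 : δ ^ 2 ≤ ‖z‖ ^ 2 := le_trans (by gcongr) h1
  rw [kernel, kernel, profile, profile, step_of_ge hδ h2, step_of_ge hr0 h1]

/-- The result is a real, nonnegative radial function carried by the ball of radius `δ`: an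
unnormalised approximate identity. Being real, it commutes with `f`. -/
lemma fueterR_kernel {δ : ℝ} (hδ : 0 < δ) (z : ℍ[ℝ]) :
    fueterR (kernel δ) z = ((density δ (‖z‖ ^ 2) : ℝ) : ℍ[ℝ]) := by
  have h1 : HasFDerivAt (fun z : ℍ[ℝ] => profile δ (‖z‖ ^ 2))
      (deriv (profile δ) (‖z‖ ^ 2) • (2 • innerSL ℝ z)) z :=
    ((contDiff_profile hδ).differentiable (by simp) _).hasDerivAt.comp_hasFDerivAt z
      (hasStrictFDerivAt_norm_sq z).hasFDerivAt
  have h2 : fueterR (fun y => sharp y) z = 4 := by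
    simp only [fueterR]
    rw [← sum_sharp_unit_mul_coef]
    simp
  have h3 := fueterR_smul h1.differentiableAt sharp.differentiableAt
  have h4 : fueterR (kernel δ) z = _ := h3
  rw [h4, h2, h1.fderiv]
  have h5 : ∀ l, ((deriv (profile δ) (‖z‖ ^ 2) • (2 • innerSL ℝ z)) (unit l)) •
      (sharp z * coef l) = (2 * deriv (profile δ) (‖z‖ ^ 2)) •
        (inner ℝ z (unit l) • (sharp z * coef l)) := by
    intro l
    rw [smul_smul]
    congr 1
    simp
    ring
  simp_rw [h5, ← Finset.smul_sum, sum_inner_smul_sharp_mul_coef, density]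
  rw [show (4 : ℍ[ℝ]) = ((4 : ℝ) : ℍ[ℝ]) by norm_cast, ← Quaternion.coe_smul,
    ← Quaternion.coe_smul, ← Quaternion.coe_add]
  congr 1
  simp only [smul_eq_mul]
  ring

/-! ### Weak solutions of the Cauchy-Fueter equation are smooth -/

lemma fueterR_comp_sub (f : ℍ[ℝ] → ℍ[ℝ]) (x y : ℍ[ℝ]) :
    fueterR (fun y => f (y - x)) y = fueterR f (y - x) := by
  simp only [fueterR, fderiv_comp_sub]

section Weyl

variable [MeasurableSpace ℍ[ℝ]] [BorelSpace ℍ[ℝ]] {μ : Measure ℍ[ℝ]} [μ.IsAddHaarMeasure]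

lemma integrable_mul_of_bounded {g f : ℍ[ℝ] → ℍ[ℝ]} (hg : Continuous g)
    (hc : HasCompactSupport g) (hf : AEStronglyMeasurable f μ) {K : ℝ} (hK : ∀ x, ‖f x‖ ≤ K) :
    Integrable (fun x => g x * f x) μ :=
  (hg.integrable_of_hasCompactSupport hc).mul_bdd (c := K) hf (ae_of_all _ hK)

/-- The density of the potential that represents a weak solution `f` where `χ = 1`. -/
noncomputable def potentialDensity (χ : ℍ[ℝ] → ℝ) (f : ℍ[ℝ] → ℍ[ℝ]) (y : ℍ[ℝ]) : ℍ[ℝ] :=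
  (∑ l, fderiv ℝ χ y (unit l) • coef l) * f y

/-- Test the weak equation against `χ * kernel δ (· - x)`. The derivative of the kernel gives the
left side, the derivative of `χ` the right side. Since `χ` is constant on the ball of radius `R /
2`, the latter only sees points at distance at least `R / 4` from `x`, where the kernel no longer
depends on `δ`. -/
lemma potential_eq {x₀ x : ℍ[ℝ]} {R K δ : ℝ} (χ : ContDiffBump x₀) (hin : χ.rIn = R / 2)
    (hout : χ.rOut < R) {f : ℍ[ℝ] → ℍ[ℝ]} (hm : AEStronglyMeasurable f μ) (hK : ∀ x, ‖f x‖ ≤ K)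
    (hw : ∀ Ψ : ℍ[ℝ] → ℍ[ℝ], ContDiff ℝ ∞ Ψ → HasCompactSupport Ψ → tsupport Ψ ⊆ ball x₀ R →
      ∫ y, fueterR Ψ y * f y ∂μ = 0)
    (hx : x ∈ ball x₀ (R / 4)) (hδ : 0 < δ) (hδR : δ ≤ R / 4) :
    ∫ y, (χ y * density δ (‖y - x‖ ^ 2)) • f y ∂μ =
      -∫ y, kernel (R / 4) (y - x) * potentialDensity χ f y ∂μ := by
  have hE : ContDiff ℝ ∞ fun y => kernel δ (y - x) := (contDiff_kernel hδ).comp (by fun_prop)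
  have hχ : ContDiff ℝ ∞ χ := χ.contDiff
  set Ψ : ℍ[ℝ] → ℍ[ℝ] := fun y => χ y • kernel δ (y - x) with hΨdef
  have hΨ : ContDiff ℝ ∞ Ψ := hχ.smul hE
  have hΨs : tsupport Ψ ⊆ tsupport χ := tsupport_smul_subset_left _ _
  have hΨc : HasCompactSupport Ψ := χ.hasCompactSupport.smul_right
  have key := hw Ψ hΨ hΨc (hΨs.trans (by
    rw [χ.tsupport_eq]; exact closedBall_subset_ball hout))
  have hpt : ∀ y, fueterR Ψ y * f y = (χ y * density δ (‖y - x‖ ^ 2)) • f y +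
      kernel (R / 4) (y - x) * potentialDensity χ f y := by
    intro y
    rw [hΨdef, fueterR_smul (hχ.differentiable (by simp) y) (hE.differentiable (by simp) y),
      fueterR_comp_sub, fueterR_kernel hδ, add_mul]
    congr 1
    · rw [smul_mul_assoc, Quaternion.coe_mul_eq_smul, smul_smul]
    · rw [potentialDensity, ← mul_assoc, Finset.mul_sum]
      congr 1
      by_cases hy : y ∈ ball x₀ (R / 2)
      · have h0 : fderiv ℝ χ y = 0 := by
          have : (χ : ℍ[ℝ] → ℝ) =ᶠ[𝓝 y] fun _ => 1 :=
            χ.eventuallyEq_one_of_mem_ball (by rwa [hin])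
          rw [this.fderiv_eq]; simp
        simp [h0]
      · have h1 : R / 4 ≤ ‖y - x‖ := by
          rw [mem_ball, not_lt] at hy
          rw [mem_ball] at hx
          have := dist_triangle y x x₀
          rw [← dist_eq_norm]
          linarith
        rw [kernel_eq hδ hδR h1]
        simp
  have hi1 : Integrable (fun y => fueterR Ψ y * f y) μ :=
    integrable_mul_of_bounded (continuous_fueterR hΨ) (hasCompactSupport_fueterR hΨc) hm hK
  have hi2 : Integrable (fun y => (χ y * density δ (‖y - x‖ ^ 2)) • f y) μ := by
    have hc : Continuous fun y => ((χ y * density δ (‖y - x‖ ^ 2) : ℝ) : ℍ[ℝ]) := by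
      have := continuous_density hδ
      have := hχ.continuous
      exact Quaternion.continuous_coe.comp (by fun_prop)
    have hcs : HasCompactSupport fun y => ((χ y * density δ (‖y - x‖ ^ 2) : ℝ) : ℍ[ℝ]) :=
      χ.hasCompactSupport.mono fun y hy h => hy (by simp [h])
    simpa only [Quaternion.coe_mul_eq_smul] using integrable_mul_of_bounded hc hcs hm hK
  have hi3 : Integrable (fun y => kernel (R / 4) (y - x) * potentialDensity χ f y) μ := by
    refine (hi1.sub hi2).congr (ae_of_all _ fun y => ?_)
    simp [hpt]
  simp_rw [hpt] at key
  rw [integral_add hi2 hi3] at key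
  exact eq_neg_of_add_eq_zero_left key

/-- The integral is a convolution of an integrable function with a smooth kernel, so all derivatives
in `x` fall on the kernel and no regularity of `f` is needed. -/
lemma contDiffOn_potential {x₀ : ℍ[ℝ]} {R K : ℝ} (hR : 0 < R) (χ : ContDiffBump x₀)
    (hout : χ.rOut < R) {f : ℍ[ℝ] → ℍ[ℝ]} (hm : AEStronglyMeasurable f μ) (hK : ∀ x, ‖f x‖ ≤ K) :
    ContDiffOn ℝ ∞ (fun x => -∫ y, kernel (R / 4) (y - x) * potentialDensity χ f y ∂μ)
      (ball x₀ (R / 4)) := by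
  have hχ : ContDiff ℝ ∞ χ := χ.contDiff
  have hg : Integrable (potentialDensity χ f) μ := by
    refine integrable_mul_of_bounded ?_ ?_ hm hK
    · have := hχ.continuous_fderiv (by simp)
      fun_prop
    · refine χ.hasCompactSupport.mono' fun y hy => ?_
      by_contra h
      exact hy (by simp [fderiv_of_notMem_tsupport (𝕜 := ℝ) h])
  -- The kernel lacks compact support, so it is truncated. The truncation is invisible for `x` in
  -- the small ball and `y` in the support of `χ`, because then `‖x - y‖ < R / 4 + R < 2 * R`.
  set b : ContDiffBump (0 : ℍ[ℝ]) := ⟨2 * R, 3 * R, by linarith, by linarith⟩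
  have hconv : ContDiff ℝ ∞ (convolution (potentialDensity χ f)
      (fun z => b z • kernel (R / 4) (-z)) (ContinuousLinearMap.mul ℝ ℍ[ℝ]).flip μ) :=
    HasCompactSupport.contDiff_convolution_right _ b.hasCompactSupport.smul_right
      hg.locallyIntegrable
      (b.contDiff.smul ((contDiff_kernel (by linarith)).comp contDiff_neg))
  refine hconv.neg.contDiffOn.congr fun x hx => ?_
  rw [convolution_def]
  congr 1
  refine integral_congr_ae (ae_of_all _ fun y => ?_)
  simp only [ContinuousLinearMap.flip_apply, ContinuousLinearMap.mul_apply', neg_sub]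
  by_cases hy : y ∈ tsupport χ
  · rw [b.one_of_mem_closedBall, one_smul]
    rw [χ.tsupport_eq] at hy
    rw [mem_closedBall] at hy ⊢
    rw [mem_ball] at hx
    have := dist_triangle_right x y x₀
    rw [dist_zero_right, ← dist_eq_norm]
    change dist x y ≤ 2 * R
    linarith
  · simp [potentialDensity, fderiv_of_notMem_tsupport (𝕜 := ℝ) hy]

/-- A bounded weak solution of the Cauchy-Fueter equation agrees with a smooth function at its
points of continuity. -/
theorem exists_contDiffOn_of_weak {x₀ : ℍ[ℝ]} {R K : ℝ} (hR : 0 < R) {f : ℍ[ℝ] → ℍ[ℝ]}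
    (hm : AEStronglyMeasurable f μ) (hK : ∀ x, ‖f x‖ ≤ K)
    (hw : ∀ Ψ : ℍ[ℝ] → ℍ[ℝ], ContDiff ℝ ∞ Ψ → HasCompactSupport Ψ → tsupport Ψ ⊆ ball x₀ R →
      ∫ y, fueterR Ψ y * f y ∂μ = 0) :
    ∃ F : ℍ[ℝ] → ℍ[ℝ], ContDiffOn ℝ ∞ F (ball x₀ (R / 4)) ∧
      ∀ x ∈ ball x₀ (R / 4), ContinuousAt f x → F x = f x := by
  set χ : ContDiffBump x₀ := ⟨R / 2, 3 * R / 4, by linarith, by linarith⟩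
  have hout : χ.rOut < R := by change 3 * R / 4 < R; linarith
  set P : (ℍ[ℝ] → ℍ[ℝ]) → ℍ[ℝ] → ℍ[ℝ] := fun g x =>
    -∫ y, kernel (R / 4) (y - x) * potentialDensity χ g y ∂μ
  have hPf : ContDiffOn ℝ ∞ (P f) (ball x₀ (R / 4)) := contDiffOn_potential hR χ hout hm hK
  have hP1 : ContDiffOn ℝ ∞ (P fun _ => 1) (ball x₀ (R / 4)) :=
    contDiffOn_potential (K := 1) hR χ hout aestronglyMeasurable_const (by simp)
  set w : ℝ → ℍ[ℝ] → ℍ[ℝ] → ℝ := fun δ x y => χ y * density δ (‖y - x‖ ^ 2)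
  have hwf : ∀ x ∈ ball x₀ (R / 4), ∀ δ, 0 < δ → δ ≤ R / 4 →
      ∫ y, w δ x y • f y ∂μ = P f x := fun x hx δ hδ hδR =>
    potential_eq χ rfl hout hm hK hw hx hδ hδR
  have hone : HyperholomorphicOn (fun _ => 1) univ :=
    ⟨contDiffOn_const, fun q _ => (cauchyFueter_eq_zero_iff _ q).2 (by simp [fueterL])⟩
  -- The constant `1` is itself a solution. Applying the representation to it shows that the mass of
  -- the weight is independent of `δ` and smooth in `x`, so the mass never has to be computed: `P f`
  -- is divided by it.
  have hw1 : ∀ x ∈ ball x₀ (R / 4), ∀ δ, 0 < δ → δ ≤ R / 4 →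
      ∫ y, w δ x y • (1 : ℍ[ℝ]) ∂μ = P (fun _ => 1) x := fun x hx δ hδ hδR =>
    potential_eq (K := 1) χ rfl hout aestronglyMeasurable_const (by simp)
      (fun Ψ h1 h2 _ => hone.integral_fueterR_mul μ isOpen_univ h1 h2 (subset_univ _)) hx hδ hδR
  have hwc : ∀ δ x, 0 < δ → Continuous (w δ x) := fun δ x hδ => by
    have := continuous_density hδ
    have := χ.continuous
    fun_prop
  have hwcs : ∀ δ x, HasCompactSupport (w δ x) := fun δ x => χ.hasCompactSupport.mul_right
  have hwi : ∀ δ x, 0 < δ → Integrable (w δ x) μ := fun δ x hδ =>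
    (hwc δ x hδ).integrable_of_hasCompactSupport (hwcs δ x)
  have hw0 : ∀ δ x y, 0 < δ → 0 ≤ w δ x y := fun δ x y hδ =>
    mul_nonneg χ.nonneg (density_nonneg hδ (by positivity))
  have hre : ∀ x ∈ ball x₀ (R / 4), ∀ δ, 0 < δ → δ ≤ R / 4 →
      ∫ y, w δ x y ∂μ = (P (fun _ => 1) x).re := fun x hx δ hδ hδR => by
    rw [← hw1 x hx δ hδ hδR, integral_smul_const]
    simp
  have hpos : ∀ x ∈ ball x₀ (R / 4), 0 < (P (fun _ => 1) x).re := by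
    intro x hx
    have hR4 : 0 < R / 4 := by linarith
    rw [← hre x hx _ hR4 le_rfl]
    obtain ⟨s, hs, hs'⟩ := exists_density_ne_zero hR4
    have hsR : s ≤ (R / 4) ^ 2 := by
      by_contra h
      exact hs' (density_of_gt hR4 (not_le.1 h))
    -- The witness lies at distance `√s ≤ R / 4` from `x`, where the density is nonzero, and still
    -- within `R / 2` of `x₀`, where `χ = 1`.
    refine (hwc _ x hR4).integral_pos_of_hasCompactSupport_nonneg_nonzero (hwcs _ x)
      (fun y => hw0 _ x y hR4) (x := x + ((√s : ℝ) : ℍ[ℝ])) ?_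
    have hn : ‖((√s : ℝ) : ℍ[ℝ])‖ = √s := by
      rw [Quaternion.norm_coe, Real.norm_of_nonneg (Real.sqrt_nonneg s)]
    have hs4 : √s ≤ R / 4 := Real.sqrt_le_iff.2 ⟨hR4.le, hsR⟩
    refine mul_ne_zero ?_ ?_
    · rw [χ.one_of_mem_closedBall]
      · exact one_ne_zero
      · rw [mem_closedBall, dist_eq_norm]
        rw [mem_ball, dist_eq_norm] at hx
        have := norm_add_le (x - x₀) ((√s : ℝ) : ℍ[ℝ])
        rw [show x + ((√s : ℝ) : ℍ[ℝ]) - x₀ = x - x₀ + ((√s : ℝ) : ℍ[ℝ]) by abel]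
        change _ ≤ R / 2
        linarith
    · rwa [add_sub_cancel_left, hn, Real.sq_sqrt hs.le]
  refine ⟨fun x => ((P (fun _ => 1) x).re)⁻¹ • P f x, ?_, fun x hx hcont => ?_⟩
  · refine ContDiffOn.smul (ContDiffOn.inv ?_ fun x hx => (hpos x hx).ne') hPf
    have hlin : ContDiff ℝ ∞ (fun q : ℍ[ℝ] => q.re) := by
      have : (fun q : ℍ[ℝ] => q.re) = fun q => inner ℝ 1 q := by
        funext q; simp [Quaternion.inner_def]
      rw [this]
      exact contDiff_const.inner ℝ contDiff_id
    exact hlin.comp_contDiffOn hP1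
  · have hc := hpos x hx
    have hC := fun δ => hre x hx δ
    set C := (P (fun _ => 1) x).re
    suffices h : P f x = C • f x by
      change C⁻¹ • P f x = f x
      rw [h, smul_smul, inv_mul_cancel₀ hc.ne', one_smul]
    -- The weight is nonnegative, has mass `C` and lives in the ball of radius `δ` about `x`. If `f`
    -- varies by less than `ε / C` on that ball, the weighted mean differs from `C • f x` by at most
    -- `ε`.
    rw [← sub_eq_zero, ← norm_le_zero_iff]
    refine le_of_forall_pos_le_add fun ε hε => ?_
    obtain ⟨d, hd, hd'⟩ := Metric.continuousAt_iff.1 hcont (ε / C) (by positivity)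
    set δ := min (d / 2) (R / 4)
    have hδ : 0 < δ := lt_min (by linarith) (by linarith)
    have hδR : δ ≤ R / 4 := min_le_right _ _
    have hδd : δ < d := (min_le_left _ _).trans_lt (by linarith)
    have hif : Integrable (fun y => w δ x y • f y) μ :=
      (hwi δ x hδ).smul_bdd K hm (ae_of_all _ hK)
    have hi1 : Integrable (fun y => w δ x y • f x) μ := (hwi δ x hδ).smul_const _
    rw [← hwf x hx δ hδ hδR, ← hC δ hδ hδR, ← integral_smul_const, ← integral_sub hif hi1,
      zero_add]
    calc ‖∫ y, (w δ x y • f y - w δ x y • f x) ∂μ‖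
        ≤ ∫ y, w δ x y * (ε / C) ∂μ := by
          refine norm_integral_le_of_norm_le ((hwi δ x hδ).mul_const _) (ae_of_all _ fun y => ?_)
          rw [← smul_sub, norm_smul, Real.norm_of_nonneg (hw0 δ x y hδ)]
          by_cases hy : ‖y - x‖ ≤ δ
          · refine mul_le_mul_of_nonneg_left ?_ (hw0 δ x y hδ)
            have := hd' (x := y) (by rw [dist_eq_norm]; linarith)
            rw [dist_eq_norm] at this
            exact this.le
          · have : w δ x y = 0 := by
              simp only [w]
              rw [density_of_gt hδ, mul_zero]
              gcongr
              exact not_le.1 hy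
            rw [this]; simp
      _ = ε := by
          rw [integral_mul_const, hC δ hδ hδR]
          field_simp

end Weyl

lemma continuous_fderiv_apply_const {F : Type*} [NormedAddCommGroup F] [NormedSpace ℝ F]
    {u : ℍ[ℝ] → F} (hu : ContDiff ℝ ∞ u) (v : ℍ[ℝ]) : Continuous fun y => fderiv ℝ u y v :=
  (hu.continuous_fderiv (by simp)).clm_apply continuous_const

/-! ### Removing an exceptional set from the weak equation by cutoffs -/

section Cutoff

variable [MeasurableSpace ℍ[ℝ]] [BorelSpace ℍ[ℝ]] {μ : Measure ℍ[ℝ]} [μ.IsAddHaarMeasure]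

/-- A bounded function that is hyperholomorphic off `S` is a weak solution of the Cauchy-Fueter
equation if there are good cutoff functions that vanish near `S`. -/
lemma integral_fueterR_mul_eq_zero_of_cutoff {O S : Set ℍ[ℝ]} (hO : IsOpen (O \ S))
    {f : ℍ[ℝ] → ℍ[ℝ]} {K : ℝ} (hm : AEStronglyMeasurable f μ) (hK : ∀ x, ‖f x‖ ≤ K)
    (hf : HyperholomorphicOn f (O \ S)) (χ : ℕ → ℍ[ℝ] → ℝ) (hχ : ∀ k, ContDiff ℝ ∞ (χ k))
    (hχ1 : ∀ k y, |χ k y| ≤ 1) (hχS : ∀ k, Disjoint (tsupport (χ k)) S)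
    (hlim : ∀ᵐ y ∂μ, y ∈ O → Tendsto (fun k => χ k y) atTop (𝓝 1))
    {Ψ : ℍ[ℝ] → ℍ[ℝ]} (hΨ : ContDiff ℝ ∞ Ψ) (hΨc : HasCompactSupport Ψ) (hΨO : tsupport Ψ ⊆ O)
    (hlim' : ∀ l, Tendsto (fun k => ∫ y, fderiv ℝ (χ k) y (unit l) • (Ψ y * coef l * f y) ∂μ)
      atTop (𝓝 0)) :
    ∫ y, fueterR Ψ y * f y ∂μ = 0 := by
  have hint : Integrable (fun y => fueterR Ψ y * f y) μ :=
    integrable_mul_of_bounded (continuous_fueterR hΨ) (hasCompactSupport_fueterR hΨc) hm hK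
  have h1 : Tendsto (fun k => ∫ y, χ k y • (fueterR Ψ y * f y) ∂μ) atTop
      (𝓝 (∫ y, fueterR Ψ y * f y ∂μ)) := by
    refine tendsto_integral_of_dominated_convergence (fun y => ‖fueterR Ψ y * f y‖)
      (fun k => (hχ k).continuous.aestronglyMeasurable.smul hint.1) hint.norm
      (fun k => ae_of_all _ fun y => ?_) ?_
    · rw [norm_smul]
      exact mul_le_of_le_one_left (norm_nonneg _) (hχ1 k y)
    · filter_upwards [hlim] with y hy
      by_cases hyΨ : y ∈ tsupport Ψ
      · simpa using (hy (hΨO hyΨ)).smul_const (fueterR Ψ y * f y)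
      · simp [fueterR_eq_zero_of_notMem_tsupport hyΨ]
  have hint2 : ∀ k l, Integrable
      (fun y => fderiv ℝ (χ k) y (unit l) • (Ψ y * coef l * f y)) μ := by
    intro k l
    have h2 := continuous_fderiv_apply_const (hχ k) (unit l)
    have h3 : HasCompactSupport fun y => fderiv ℝ (χ k) y (unit l) • (Ψ y * coef l) :=
      hΨc.mono fun y hy h => hy (by simp [h])
    have : Integrable (fun y => (fderiv ℝ (χ k) y (unit l) • (Ψ y * coef l)) * f y) μ :=
      integrable_mul_of_bounded (h2.smul (hΨ.continuous.mul continuous_const)) h3 hm hK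
    simpa only [smul_mul_assoc] using this
  -- The product `χ k • Ψ` is an admissible test function on `O \ S`. The product rule splits its
  -- weak equation into the truncated integral and the gradient terms assumed to tend to zero.
  have h2 : ∀ k, ∫ y, χ k y • (fueterR Ψ y * f y) ∂μ =
      -∑ l, ∫ y, fderiv ℝ (χ k) y (unit l) • (Ψ y * coef l * f y) ∂μ := by
    intro k
    have hs : tsupport (fun y => χ k y • Ψ y) ⊆ tsupport (χ k) ∩ tsupport Ψ :=
      subset_inter (tsupport_smul_subset_left _ _) (tsupport_smul_subset_right _ _)
    have h3 := hf.integral_fueterR_mul μ hO ((hχ k).smul hΨ) hΨc.smul_left fun y hy =>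
      ⟨hΨO (hs hy).2, fun hyS => disjoint_left.1 (hχS k) (hs hy).1 hyS⟩
    have h4 : ∀ y, fueterR (fun y => χ k y • Ψ y) y * f y = χ k y • (fueterR Ψ y * f y) +
        ∑ l, fderiv ℝ (χ k) y (unit l) • (Ψ y * coef l * f y) := by
      intro y
      rw [fueterR_smul ((hχ k).differentiable (by simp) y) (hΨ.differentiable (by simp) y),
        add_mul, Finset.sum_mul]
      simp only [smul_mul_assoc]
    have h5 : ∫ y, fueterR (fun y => χ k y • Ψ y) y * f y ∂μ = 0 := h3
    simp_rw [h4] at h5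
    rw [integral_add _ (integrable_finsetSum _ fun l _ => hint2 k l),
      integral_finsetSum _ fun l _ => hint2 k l] at h5
    · exact eq_neg_of_add_eq_zero_left h5
    · exact hint.bdd_smul 1 (hχ k).continuous.aestronglyMeasurable (ae_of_all _ (hχ1 k))
  have h3 : Tendsto (fun k => ∫ y, χ k y • (fueterR Ψ y * f y) ∂μ) atTop (𝓝 0) := by
    simp_rw [h2]
    simpa using (tendsto_finsetSum Finset.univ fun l _ => hlim' l).neg
  exact tendsto_nhds_unique h1 h3

/-! ### Bounded functions with an isolated singularity -/

/-- Rescaling by `k + 1` in real dimension four multiplies the derivative by `k + 1` and the volume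
by `(k + 1)⁻⁴`, leaving the factor `(k + 1)⁻³`. Thus a point is negligible even for merely bounded
functions. -/
lemma tendsto_integral_norm_fderiv_comp_smul {χ : ℍ[ℝ] → ℝ} (hχ : ContDiff ℝ ∞ χ)
    (a v : ℍ[ℝ]) :
    Tendsto (fun k : ℕ => ∫ y, ‖fderiv ℝ (fun z => χ (((k : ℝ) + 1) • (z - a))) y v‖ ∂μ)
      atTop (𝓝 0) := by
  have h1 : ∀ k : ℕ, ∫ y, ‖fderiv ℝ (fun z => χ (((k : ℝ) + 1) • (z - a))) y v‖ ∂μ =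
      (((k : ℝ) + 1) ^ 3)⁻¹ * ∫ y, ‖fderiv ℝ χ y v‖ ∂μ := by
    intro k
    have hk : (0 : ℝ) < (k : ℝ) + 1 := by positivity
    have h2 : ∀ y, ‖fderiv ℝ (fun z => χ (((k : ℝ) + 1) • (z - a))) y v‖ =
        ((k : ℝ) + 1) * ‖fderiv ℝ χ (((k : ℝ) + 1) • (y - a)) v‖ := by
      intro y
      have h3 : HasFDerivAt (fun z : ℍ[ℝ] => ((k : ℝ) + 1) • (z - a))
          (((k : ℝ) + 1) • ContinuousLinearMap.id ℝ ℍ[ℝ]) y :=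
        ((hasFDerivAt_id y).sub_const a).const_smul ((k : ℝ) + 1)
      have h4 : HasFDerivAt (fun z => χ (((k : ℝ) + 1) • (z - a))) _ y :=
        ((hχ.differentiable (by simp)) _).hasFDerivAt.comp y h3
      rw [h4.fderiv]
      simp [abs_of_pos hk]
    simp_rw [h2]
    rw [integral_const_mul, integral_sub_right_eq_self (μ := μ)
      (fun y => ‖fderiv ℝ χ (((k : ℝ) + 1) • y) v‖) a,
      Measure.integral_comp_smul μ (fun y => ‖fderiv ℝ χ y v‖), Quaternion.finrank_eq_four,
      abs_of_pos (by positivity), smul_eq_mul, ← mul_assoc]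
    congr 1
    field_simp
  simp_rw [h1]
  rw [← zero_mul (∫ y, ‖fderiv ℝ χ y v‖ ∂μ)]
  refine Tendsto.mul_const _ (tendsto_inv_atTop_zero.comp ?_)
  exact (tendsto_pow_atTop (by norm_num)).comp
    (tendsto_atTop_add_const_right _ _ tendsto_natCast_atTop_atTop)

end Cutoff

/-- A bounded hyperholomorphic function on a punctured neighbourhood extends over the
puncture. -/
theorem exists_hyperholomorphicOn_extension {a : ℍ[ℝ]} {R K : ℝ} (hR : 0 < R) {f : ℍ[ℝ] → ℍ[ℝ]}
    (hf : HyperholomorphicOn f (ball a R \ {a})) (hK : ∀ x ∈ ball a R \ {a}, ‖f x‖ ≤ K) :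
    ∃ (F : ℍ[ℝ] → ℍ[ℝ]) (r : ℝ), 0 < r ∧ HyperholomorphicOn F (ball a r) ∧
      ∀ x ∈ ball a r, x ≠ a → F x = f x := by
  borelize ℍ[ℝ]
  set μ : Measure ℍ[ℝ] := Measure.addHaar
  have hO : IsOpen (ball a R \ {a}) := isOpen_ball.sdiff isClosed_singleton
  set g := (ball a R \ {a}).indicator f with hg
  have hgf : EqOn g f (ball a R \ {a}) := fun x hx => indicator_of_mem hx f
  have hgm : AEStronglyMeasurable g μ :=
    (aestronglyMeasurable_indicator_iff hO.measurableSet).2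
      (hf.1.continuousOn.aestronglyMeasurable hO.measurableSet)
  have hK0 : 0 ≤ max K 0 := le_max_right _ _
  have hgK : ∀ x, ‖g x‖ ≤ max K 0 := fun x => by
    by_cases hx : x ∈ ball a R \ {a}
    · rw [hgf hx]; exact (hK x hx).trans (le_max_left _ _)
    · rw [hg, indicator_of_notMem hx, norm_zero]; exact hK0
  have hgh : HyperholomorphicOn g (ball a R \ {a}) := hf.congr hO hgf
  -- This vanishes near the origin and equals `1` outside the unit ball. Its rescalings about `a`
  -- are cutoffs whose transition zones shrink to `a`.
  set χ : ℍ[ℝ] → ℝ := fun z => step 1 (‖z‖ ^ 2)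
  have hχ : ContDiff ℝ ∞ χ := (contDiff_step 1).comp (contDiff_norm_sq ℝ)
  have hχ1 : ∀ z, |χ z| ≤ 1 := fun z => by
    have h0 : 0 ≤ χ z := Real.smoothTransition.nonneg _
    rw [abs_of_nonneg h0]
    exact Real.smoothTransition.le_one _
  have hχk : ∀ k : ℕ, ContDiff ℝ ∞ fun z => χ (((k : ℝ) + 1) • (z - a)) := fun k =>
    hχ.comp (by fun_prop)
  have hweak : ∀ Ψ : ℍ[ℝ] → ℍ[ℝ], ContDiff ℝ ∞ Ψ → HasCompactSupport Ψ →
      tsupport Ψ ⊆ ball a R → ∫ y, fueterR Ψ y * g y ∂μ = 0 := by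
    intro Ψ hΨ hΨc hΨs
    refine integral_fueterR_mul_eq_zero_of_cutoff hO hgm hgK hgh
      (fun k z => χ (((k : ℝ) + 1) • (z - a))) hχk (fun k z => hχ1 _) (fun k => ?_) ?_ hΨ hΨc
      hΨs (fun l => ?_)
    · rw [disjoint_singleton_right, notMem_tsupport_iff_eventuallyEq]
      have h1 : ContinuousAt (fun z : ℍ[ℝ] => ‖((k : ℝ) + 1) • (z - a)‖ ^ 2) a := by fun_prop
      have h2 : ∀ᶠ z in 𝓝 a, ‖((k : ℝ) + 1) • (z - a)‖ ^ 2 < 1 / 2 :=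
        h1.eventually_lt continuousAt_const (by norm_num)
      filter_upwards [h2] with z hz
      exact step_of_le one_pos (by norm_num; linarith)
    · filter_upwards [compl_mem_ae_iff.2 (measure_singleton (μ := μ) a)] with y hy _
      have hy0 : 0 < ‖y - a‖ := norm_pos_iff.2 (sub_ne_zero.2 hy)
      refine tendsto_const_nhds.congr' ?_
      filter_upwards [(tendsto_natCast_atTop_atTop (R := ℝ)).eventually_ge_atTop ‖y - a‖⁻¹]
        with k hk
      have h1 : 1 ≤ ((k : ℝ) + 1) * ‖y - a‖ := by
        rw [inv_le_iff_one_le_mul₀ hy0] at hk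
        nlinarith
      refine (step_of_ge one_pos ?_).symm
      rw [norm_smul, Real.norm_of_nonneg (by positivity)]
      gcongr
    · obtain ⟨C, hC⟩ := (hΨc.isCompact_range hΨ.continuous).isBounded.exists_norm_le
      have hlim := (tendsto_integral_norm_fderiv_comp_smul (μ := μ) hχ a (unit l)).const_mul
        (C * ‖coef l‖ * max K 0)
      rw [mul_zero] at hlim
      refine squeeze_zero_norm (fun k => ?_) hlim
      rw [← integral_const_mul]
      refine norm_integral_le_of_norm_le ?_ (ae_of_all _ fun y => ?_)
      · refine Integrable.const_mul (Integrable.norm ?_) _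
        refine (continuous_fderiv_apply_const (hχk k) _).integrable_of_hasCompactSupport ?_
        refine (isCompact_closedBall a 1).of_isClosed_subset (isClosed_tsupport _) ?_
        refine closure_minimal (fun y hy => ?_) isClosed_closedBall
        by_contra hya
        rw [mem_closedBall, not_le, dist_eq_norm] at hya
        have h2 : (fun z => χ (((k : ℝ) + 1) • (z - a))) =ᶠ[𝓝 y] fun _ => 1 := by
          have h3 : ContinuousAt (fun z : ℍ[ℝ] => ‖z - a‖) y := by fun_prop
          filter_upwards [continuousAt_const.eventually_lt h3 hya] with z hz
          refine step_of_ge one_pos ?_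
          rw [norm_smul, Real.norm_of_nonneg (by positivity)]
          gcongr
          nlinarith [Nat.cast_nonneg (α := ℝ) k]
        exact hy (by simp [h2.fderiv_eq])
      · rw [norm_smul, norm_mul, norm_mul, mul_comm]
        have := hC _ (mem_range_self y)
        have hC0 : 0 ≤ C := (norm_nonneg _).trans this
        gcongr
        exact hgK y
  obtain ⟨F, hF, hFg⟩ := exists_contDiffOn_of_weak hR hgm hgK hweak
  have hsub : ball a (R / 4) ⊆ ball a R := ball_subset_ball (by linarith)
  have hFf : ∀ x ∈ ball a (R / 4), x ≠ a → F x = f x := fun x hx hxa => by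
    have hx' : x ∈ ball a R \ {a} := ⟨hsub hx, hxa⟩
    rw [hFg x hx (hgh.1.continuousOn.continuousAt (hO.mem_nhds hx')), hgf hx']
  refine ⟨F, R / 4, by linarith, ?_, hFf⟩
  refine hyperholomorphicOn_of_dense (S := {a}) isOpen_ball hF (interior_singleton a) ?_
  exact ((hf.mono (sdiff_subset_sdiff_left hsub)).congr (isOpen_ball.sdiff isClosed_singleton)
    fun x hx => hFf x hx.1 hx.2).2

/-! ### Cutoff functions along a hypersurface -/

/-- A smooth step function from `0` on `(-∞, 1/2]` to `1` on `[1, ∞)`. -/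
noncomputable def ramp (u : ℝ) : ℝ := step 1 u

lemma contDiff_ramp : ContDiff ℝ ∞ ramp := contDiff_step 1

lemma deriv_ramp_nonneg (u : ℝ) : 0 ≤ deriv ramp u := (monotone_step 1).deriv_nonneg

lemma ramp_nonneg (u : ℝ) : 0 ≤ ramp u := Real.smoothTransition.nonneg _

lemma ramp_le_one (u : ℝ) : ramp u ≤ 1 := Real.smoothTransition.le_one _

lemma ramp_of_le {u : ℝ} (h : u ≤ 1 / 2) : ramp u = 0 := step_of_le one_pos (by simpa using h)

lemma ramp_of_ge {u : ℝ} (h : 1 ≤ u) : ramp u = 1 := step_of_ge one_pos (by simpa using h)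

/-- A cutoff function that vanishes near `φ = 0`. -/
noncomputable def cutoff (φ : ℍ[ℝ] → ℝ) (k : ℕ) (y : ℍ[ℝ]) : ℝ :=
  ramp (((k : ℝ) + 1) * φ y) + ramp (-((k : ℝ) + 1) * φ y)

/-- The odd companion of `cutoff`, which is monotone in `φ`. -/
noncomputable def oddCutoff (φ : ℍ[ℝ] → ℝ) (k : ℕ) (y : ℍ[ℝ]) : ℝ :=
  ramp (((k : ℝ) + 1) * φ y) - ramp (-((k : ℝ) + 1) * φ y)

section

variable {φ : ℍ[ℝ] → ℝ}

lemma contDiff_ramp_mul (hφ : ContDiff ℝ ∞ φ) (c : ℝ) : ContDiff ℝ ∞ fun y => ramp (c * φ y) :=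
  contDiff_ramp.comp (contDiff_const.mul hφ)

lemma contDiff_cutoff (hφ : ContDiff ℝ ∞ φ) (k : ℕ) : ContDiff ℝ ∞ (cutoff φ k) :=
  (contDiff_ramp_mul hφ _).add (contDiff_ramp_mul hφ _)

lemma contDiff_oddCutoff (hφ : ContDiff ℝ ∞ φ) (k : ℕ) : ContDiff ℝ ∞ (oddCutoff φ k) :=
  (contDiff_ramp_mul hφ _).sub (contDiff_ramp_mul hφ _)

lemma hasFDerivAt_ramp_mul (hφ : ContDiff ℝ ∞ φ) (c : ℝ) (y : ℍ[ℝ]) :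
    HasFDerivAt (fun y => ramp (c * φ y)) (deriv ramp (c * φ y) • c • fderiv ℝ φ y) y :=
  (contDiff_ramp.differentiable (by simp) _).hasDerivAt.comp_hasFDerivAt y
    ((hφ.differentiable (by simp) y).hasFDerivAt.const_mul c)

lemma fderiv_cutoff (hφ : ContDiff ℝ ∞ φ) (k : ℕ) (y v : ℍ[ℝ]) :
    fderiv ℝ (cutoff φ k) y v = (deriv ramp (((k : ℝ) + 1) * φ y) -
      deriv ramp (-((k : ℝ) + 1) * φ y)) * ((k : ℝ) + 1) * fderiv ℝ φ y v := by
  have h : HasFDerivAt (cutoff φ k) _ y :=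
    (hasFDerivAt_ramp_mul hφ ((k : ℝ) + 1) y).add (hasFDerivAt_ramp_mul hφ (-((k : ℝ) + 1)) y)
  rw [h.fderiv]
  simp
  ring

lemma fderiv_oddCutoff (hφ : ContDiff ℝ ∞ φ) (k : ℕ) (y v : ℍ[ℝ]) :
    fderiv ℝ (oddCutoff φ k) y v = (deriv ramp (((k : ℝ) + 1) * φ y) +
      deriv ramp (-((k : ℝ) + 1) * φ y)) * ((k : ℝ) + 1) * fderiv ℝ φ y v := by
  have h : HasFDerivAt (oddCutoff φ k) _ y :=
    (hasFDerivAt_ramp_mul hφ ((k : ℝ) + 1) y).sub (hasFDerivAt_ramp_mul hφ (-((k : ℝ) + 1)) y)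
  rw [h.fderiv]
  simp
  ring

/-- The two derivatives carry the difference and the sum of the same nonnegative numbers. Since
`oddCutoff` is bounded by `1` and increases along `v`, it controls the total variation of `cutoff`
uniformly in `k`. -/
lemma abs_fderiv_cutoff_le (hφ : ContDiff ℝ ∞ φ) (k : ℕ) {y v : ℍ[ℝ]}
    (hv : 0 ≤ fderiv ℝ φ y v) :
    |fderiv ℝ (cutoff φ k) y v| ≤ fderiv ℝ (oddCutoff φ k) y v := by
  rw [fderiv_cutoff hφ, fderiv_oddCutoff hφ, abs_mul, abs_mul, abs_of_nonneg hv,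
    abs_of_nonneg (show (0 : ℝ) ≤ (k : ℝ) + 1 by positivity)]
  gcongr
  have h1 := deriv_ramp_nonneg (((k : ℝ) + 1) * φ y)
  have h2 := deriv_ramp_nonneg (-((k : ℝ) + 1) * φ y)
  rw [abs_le]
  constructor <;> linarith

lemma abs_cutoff_le (k : ℕ) (y : ℍ[ℝ]) : |cutoff φ k y| ≤ 1 := by
  have hk : (0 : ℝ) < (k : ℝ) + 1 := by positivity
  have h1 := ramp_nonneg (((k : ℝ) + 1) * φ y)
  have h2 := ramp_nonneg (-((k : ℝ) + 1) * φ y)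
  have h3 := ramp_le_one (((k : ℝ) + 1) * φ y)
  have h4 := ramp_le_one (-((k : ℝ) + 1) * φ y)
  rw [cutoff, abs_of_nonneg (by positivity)]
  rcases le_total 0 (((k : ℝ) + 1) * φ y) with h | h
  · rw [ramp_of_le (u := -((k : ℝ) + 1) * φ y) (by linarith)]; linarith
  · rw [ramp_of_le (u := ((k : ℝ) + 1) * φ y) (by linarith)]; linarith

lemma abs_oddCutoff_le (k : ℕ) (y : ℍ[ℝ]) : |oddCutoff φ k y| ≤ 1 := by
  have h1 := ramp_nonneg (((k : ℝ) + 1) * φ y)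
  have h2 := ramp_nonneg (-((k : ℝ) + 1) * φ y)
  have h3 := ramp_le_one (((k : ℝ) + 1) * φ y)
  have h4 := ramp_le_one (-((k : ℝ) + 1) * φ y)
  rw [oddCutoff, abs_le]
  constructor <;> linarith

lemma disjoint_tsupport_cutoff (hφ : Continuous φ) (k : ℕ) :
    Disjoint (tsupport (cutoff φ k)) {y | φ y = 0} := by
  refine disjoint_right.2 fun y hy => ?_
  rw [notMem_tsupport_iff_eventuallyEq]
  have hy : φ y = 0 := hy
  have h1 : ContinuousAt (fun z => ((k : ℝ) + 1) * φ z) y := by fun_prop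
  have h2 := h1.eventually_lt (g := fun _ => 1 / 2) continuousAt_const (by simp [hy])
  have h3 := (continuousAt_const (y := -(1 / 2 : ℝ))).eventually_lt h1 (by simp [hy])
  filter_upwards [h2, h3] with z hz hz'
  rw [cutoff, ramp_of_le hz.le, ramp_of_le (by linarith)]
  simp

lemma tendsto_cutoff {y : ℍ[ℝ]} (hy : φ y ≠ 0) :
    Tendsto (fun k => cutoff φ k y) atTop (𝓝 1) := by
  refine tendsto_const_nhds.congr' ?_
  have hy0 : 0 < |φ y| := abs_pos.2 hy
  filter_upwards [(tendsto_natCast_atTop_atTop (R := ℝ)).eventually_ge_atTop |φ y|⁻¹]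
    with k hk
  have h1 : 1 ≤ ((k : ℝ) + 1) * |φ y| := by
    rw [inv_le_iff_one_le_mul₀ hy0] at hk
    nlinarith
  rw [cutoff]
  rcases hy.lt_or_gt with h | h
  · rw [abs_of_neg h] at h1
    rw [ramp_of_le (by nlinarith), ramp_of_ge (by linarith), zero_add]
  · rw [abs_of_pos h] at h1
    rw [ramp_of_ge h1, ramp_of_le (by linarith), add_zero]

end

/-! ### Null level sets and cancellation of the cutoff errors along a hypersurface -/

section Measure

variable [MeasurableSpace ℍ[ℝ]] [BorelSpace ℍ[ℝ]] {μ : Measure ℍ[ℝ]} [μ.IsAddHaarMeasure]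

lemma integral_fderiv_smul_eq_neg {F : Type*} [NormedAddCommGroup F] [NormedSpace ℝ F]
    [CompleteSpace F] {u : ℍ[ℝ] → ℝ}
    {g : ℍ[ℝ] → F} (hu : ContDiff ℝ ∞ u) (hg : ContDiff ℝ ∞ g) (hgc : HasCompactSupport g)
    (v : ℍ[ℝ]) : ∫ y, fderiv ℝ u y v • g y ∂μ = -∫ y, u y • fderiv ℝ g y v ∂μ := by
  have h1 := continuous_fderiv_apply_const hu v
  have h2 := continuous_fderiv_apply_const hg v
  have h3 : HasCompactSupport fun y => fderiv ℝ g y v := hgc.fderiv_apply ℝ v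
  rw [integral_smul_fderiv_eq_neg_fderiv_smul_of_integrable (𝕜 := ℝ), neg_neg]
  · exact (h1.smul hg.continuous).integrable_of_hasCompactSupport
      (hgc.mono fun y hy h => hy (by simp [h]))
  · exact (hu.continuous.smul h2).integrable_of_hasCompactSupport
      (h3.mono fun y hy h => hy (by simp [h]))
  · exact (hu.continuous.smul hg.continuous).integrable_of_hasCompactSupport
      (hgc.mono fun y hy h => hy (by simp [h]))
  · exact fun y _ => hu.differentiable (by simp) y
  · exact fun y _ => hg.differentiable (by simp) y

/-- A regular level set is a null set. -/
lemma measure_zeros_eq_zero {φ : ℍ[ℝ] → ℝ} (hφ : ContDiff ℝ ∞ φ) {U : Set ℍ[ℝ]} (hU : IsOpen U)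
    {v : ℍ[ℝ]} (hv : ∀ y ∈ U, 0 < fderiv ℝ φ y v) : μ (U ∩ {y | φ y = 0}) = 0 := by
  refine measure_null_of_locally_null _ fun x hx => ?_
  obtain ⟨θ, hθU, hθc, hθ, hθ01, hθx⟩ :=
    exists_contDiff_tsupport_subset (n := ⊤) (hU.mem_nhds hx.1)
  have hθ0 : ∀ y, 0 ≤ θ y := fun y => (hθ01 (mem_range_self y)).1
  have hd := continuous_fderiv_apply_const hφ v
  have hint : Integrable (fun y => fderiv ℝ φ y v * θ y) μ :=
    (hd.mul hθ.continuous).integrable_of_hasCompactSupport hθc.mul_left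
  -- These weights decrease to the indicator of `φ = 0`, and `w k * ∂ᵥφ` is `(k + 1)⁻¹` times the
  -- derivative of the bounded function `arctan ((k + 1) φ)`. Integration by parts therefore makes
  -- their integrals against `θ ∂ᵥφ` tend to zero, so the level set carries no mass.
  set w : ℕ → ℍ[ℝ] → ℝ := fun k y => (1 + (((k : ℝ) + 1) * φ y) ^ 2)⁻¹
  have hwpos : ∀ k y, 0 < 1 + (((k : ℝ) + 1) * φ y) ^ 2 := fun k y => by positivity
  have hwc : ∀ k, Continuous (w k) := fun k => by
    have := hφ.continuous
    exact Continuous.inv₀ (by fun_prop) fun y => (hwpos k y).ne'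
  have hw1 : ∀ k y, |w k y| ≤ 1 := fun k y => by
    rw [abs_of_pos (inv_pos.2 (hwpos k y))]
    exact inv_le_one_of_one_le₀ (le_add_of_nonneg_right (sq_nonneg _))
  have h1 : Tendsto (fun k => ∫ y, w k y * (fderiv ℝ φ y v * θ y) ∂μ) atTop
      (𝓝 (∫ y, {y | φ y = 0}.indicator (fun y => fderiv ℝ φ y v * θ y) y ∂μ)) := by
    refine tendsto_integral_of_dominated_convergence (fun y => ‖fderiv ℝ φ y v * θ y‖)
      (fun k => (hwc k).aestronglyMeasurable.mul hint.1) hint.norm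
      (fun k => ae_of_all _ fun y => ?_) (ae_of_all _ fun y => ?_)
    · rw [norm_mul]
      exact mul_le_of_le_one_left (norm_nonneg _) (hw1 k y)
    · by_cases hy : φ y = 0
      · rw [indicator_of_mem (show y ∈ {y | φ y = 0} from hy)]
        simp [w, hy]
      · rw [indicator_of_notMem (show y ∉ {y | φ y = 0} from hy)]
        rw [← zero_mul (fderiv ℝ φ y v * θ y)]
        refine Tendsto.mul_const _ (tendsto_inv_atTop_zero.comp ?_)
        refine tendsto_atTop_add_const_left _ _ ?_
        have h2 : Tendsto (fun k : ℕ => ((k : ℝ) + 1) ^ 2 * φ y ^ 2) atTop atTop :=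
          ((tendsto_pow_atTop (by norm_num)).comp (tendsto_atTop_add_const_right _ 1
            tendsto_natCast_atTop_atTop)).atTop_mul_const (by positivity)
        simpa only [mul_pow] using h2
  have h2 : ∀ k : ℕ, ∫ y, w k y * (fderiv ℝ φ y v * θ y) ∂μ =
      -((k : ℝ) + 1)⁻¹ * ∫ y, Real.arctan (((k : ℝ) + 1) * φ y) * fderiv ℝ θ y v ∂μ := by
    intro k
    have hk : (0 : ℝ) < (k : ℝ) + 1 := by positivity
    have hu : ContDiff ℝ ∞ fun y => Real.arctan (((k : ℝ) + 1) * φ y) :=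
      Real.contDiff_arctan.comp (contDiff_const.mul hφ)
    have h3 := integral_fderiv_smul_eq_neg (μ := μ) hu hθ hθc v
    have h4 : ∀ y, fderiv ℝ (fun y => Real.arctan (((k : ℝ) + 1) * φ y)) y v =
        ((k : ℝ) + 1) * (w k y * fderiv ℝ φ y v) := by
      intro y
      have h5 : HasFDerivAt (fun y => Real.arctan (((k : ℝ) + 1) * φ y)) _ y :=
        ((hφ.differentiable (by simp) y).hasFDerivAt.const_mul ((k : ℝ) + 1)).arctan
      rw [h5.fderiv]
      simp [w]
      ring
    simp_rw [h4, smul_eq_mul, mul_assoc] at h3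
    rw [integral_const_mul] at h3
    rw [neg_mul, ← mul_neg, ← h3, ← mul_assoc, inv_mul_cancel₀ hk.ne', one_mul]
  have h3 : Tendsto (fun k => ∫ y, w k y * (fderiv ℝ φ y v * θ y) ∂μ) atTop (𝓝 0) := by
    simp_rw [h2]
    have hθi : Integrable (fun y => fderiv ℝ θ y v) μ :=
      (continuous_fderiv_apply_const hθ v).integrable_of_hasCompactSupport (hθc.fderiv_apply ℝ v)
    have hz : Tendsto (fun k : ℕ => ((k : ℝ) + 1)⁻¹ *
        ∫ y, Real.pi / 2 * ‖fderiv ℝ θ y v‖ ∂μ) atTop (𝓝 0) := by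
      rw [← zero_mul (∫ y, Real.pi / 2 * ‖fderiv ℝ θ y v‖ ∂μ)]
      exact Tendsto.mul_const _ (tendsto_inv_atTop_zero.comp (tendsto_atTop_add_const_right _ 1
        tendsto_natCast_atTop_atTop))
    refine squeeze_zero_norm (fun k => ?_) hz
    rw [norm_mul, norm_neg, norm_inv, Real.norm_of_nonneg (by positivity)]
    gcongr
    refine norm_integral_le_of_norm_le (hθi.norm.const_mul _) (ae_of_all _ fun y => ?_)
    rw [norm_mul]
    gcongr
    rw [Real.norm_eq_abs, abs_le]
    exact ⟨(Real.neg_pi_div_two_lt_arctan _).le, (Real.arctan_lt_pi_div_two _).le⟩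
  have h4 := tendsto_nhds_unique h1 h3
  have hcl : IsClosed {y | φ y = 0} := isClosed_eq hφ.continuous continuous_const
  have h5 : 0 ≤ {y | φ y = 0}.indicator (fun y => fderiv ℝ φ y v * θ y) := by
    refine fun y => indicator_nonneg (fun y _ => ?_) y
    by_cases hy : y ∈ U
    · exact mul_nonneg (hv y hy).le (hθ0 y)
    · rw [image_eq_zero_of_notMem_tsupport fun h => hy (hθU h), mul_zero]
  rw [integral_eq_zero_iff_of_nonneg h5 (hint.indicator hcl.measurableSet)] at h4
  refine ⟨{y | θ y ≠ 0} ∩ (U ∩ {y | φ y = 0}), ?_, ?_⟩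
  · refine inter_mem (mem_nhdsWithin_of_mem_nhds ?_) self_mem_nhdsWithin
    exact (isOpen_ne_fun hθ.continuous continuous_const).mem_nhds (by simp [hθx])
  · refine measure_mono_null (fun y hy => ?_) (ae_iff.1 h4)
    obtain ⟨hy1, hy2, hy3⟩ := hy
    change ¬ _ = (0 : ℝ)
    rw [indicator_of_mem hy3]
    exact mul_ne_zero (hv y hy2).ne' hy1

/-- Along a hypersurface the `L¹` norm of the gradient of the cutoff stays bounded but need not tend
to zero, so cancellation is required. For smooth `g`, integration by parts gives the limit `-∫ ∂ᵥg =
0`. A continuous `G` is approximated uniformly by such `g`, with the error controlled by the bounded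
total variation. Continuity across the hypersurface enters here. -/
lemma tendsto_integral_fderiv_cutoff {φ : ℍ[ℝ] → ℝ} (hφ : ContDiff ℝ ∞ φ) {U : Set ℍ[ℝ]}
    (hU : IsOpen U) {v : ℍ[ℝ]} (hv : ∀ y ∈ U, 0 < fderiv ℝ φ y v) {θ : ℍ[ℝ] → ℝ}
    (hθ : ContDiff ℝ ∞ θ) (hθc : HasCompactSupport θ) (hθU : tsupport θ ⊆ U) (hθ0 : ∀ y, 0 ≤ θ y)
    {G : ℍ[ℝ] → ℍ[ℝ]} (hG : Continuous G) (hGθ : ∀ y, G y ≠ 0 → θ y = 1) :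
    Tendsto (fun k => ∫ y, fderiv ℝ (cutoff φ k) y v • G y ∂μ) atTop (𝓝 0) := by
  have hsupp : ∀ g : ℍ[ℝ] → ℍ[ℝ], Function.support g ⊆ Function.support G →
      HasCompactSupport g := fun g hg => hθc.mono fun y hy => by
    simp [hGθ y (hg hy)]
  set J := ∫ y, ‖fderiv ℝ θ y v‖ ∂μ
  have hθi : Integrable (fun y => fderiv ℝ θ y v) μ :=
    (continuous_fderiv_apply_const hθ v).integrable_of_hasCompactSupport (hθc.fderiv_apply ℝ v)
  have hJ : 0 ≤ J := integral_nonneg fun y => norm_nonneg _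
  -- the total variation of the cutoff functions is bounded
  have hodd : ∀ k, ∫ y, fderiv ℝ (oddCutoff φ k) y v * θ y ∂μ ≤ J := by
    intro k
    have h := integral_fderiv_smul_eq_neg (μ := μ) (contDiff_oddCutoff hφ k) hθ hθc v
    simp only [smul_eq_mul] at h
    rw [h]
    refine (neg_le_abs _).trans ?_
    rw [← Real.norm_eq_abs]
    refine norm_integral_le_of_norm_le hθi.norm (ae_of_all _ fun y => ?_)
    rw [norm_mul]
    exact mul_le_of_le_one_left (norm_nonneg _) (abs_oddCutoff_le k y)
  rw [Metric.tendsto_atTop]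
  intro ε hε
  -- The approximant is supported where `G` is, hence where `θ = 1`. Dividing by `J + 1` instead of
  -- `J` allows `J = 0`.
  obtain ⟨g, hg, hgG, hgs⟩ := hG.exists_contDiff_approx (ε := fun _ => ε / 2 / (J + 1)) ⊤
    continuous_const (fun _ => by positivity)
  have hgc := hsupp g hgs
  have hGc := hsupp G subset_rfl
  have h1 : Tendsto (fun k => ∫ y, fderiv ℝ (cutoff φ k) y v • g y ∂μ) atTop (𝓝 0) := by
    have h2 : Tendsto (fun k => ∫ y, cutoff φ k y • fderiv ℝ g y v ∂μ) atTop
        (𝓝 (∫ y, fderiv ℝ g y v ∂μ)) := by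
      have hgi : Integrable (fun y => fderiv ℝ g y v) μ :=
        (continuous_fderiv_apply_const hg v).integrable_of_hasCompactSupport
          (hgc.fderiv_apply ℝ v)
      refine tendsto_integral_of_dominated_convergence (fun y => ‖fderiv ℝ g y v‖)
        (fun k => (contDiff_cutoff hφ k).continuous.aestronglyMeasurable.smul hgi.1) hgi.norm
        (fun k => ae_of_all _ fun y => ?_) ?_
      · rw [norm_smul]
        exact mul_le_of_le_one_left (norm_nonneg _) (abs_cutoff_le k y)
      · filter_upwards [compl_mem_ae_iff.2 (measure_zeros_eq_zero (μ := μ) hφ hU hv)] with y hy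
        by_cases hyg : y ∈ tsupport g
        · have hyU : y ∈ U := by
            refine hθU (closure_mono ?_ hyg)
            intro z hz
            simp [hGθ z (hgs hz)]
          have hy0 : φ y ≠ 0 := fun h => hy ⟨hyU, h⟩
          simpa using (tendsto_cutoff hy0).smul_const (fderiv ℝ g y v)
        · simp [fderiv_of_notMem_tsupport (𝕜 := ℝ) hyg]
    rw [integral_fderiv_eq_zero μ (hg.of_le (by simp)) hgc] at h2
    simp_rw [integral_fderiv_smul_eq_neg (contDiff_cutoff hφ _) hg hgc v]
    simpa using h2.neg
  obtain ⟨k₀, hk₀⟩ := Metric.tendsto_atTop.1 h1 (ε / 2) (by positivity)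
  refine ⟨k₀, fun k hk => ?_⟩
  have h3 := hk₀ k hk
  rw [dist_zero_right] at h3 ⊢
  have hdc := continuous_fderiv_apply_const (contDiff_cutoff hφ k) v
  have hio : Integrable (fun y => fderiv ℝ (oddCutoff φ k) y v * θ y) μ :=
    ((continuous_fderiv_apply_const (contDiff_oddCutoff hφ k) v).mul
      hθ.continuous).integrable_of_hasCompactSupport hθc.mul_left
  have hi1 : Integrable (fun y => fderiv ℝ (cutoff φ k) y v • g y) μ :=
    (hdc.smul hg.continuous).integrable_of_hasCompactSupport
      (hgc.mono fun y hy h => hy (by simp [h]))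
  have hi2 : Integrable (fun y => fderiv ℝ (cutoff φ k) y v • G y) μ :=
    (hdc.smul hG).integrable_of_hasCompactSupport
      (hGc.mono fun y hy h => hy (by simp [h]))
  have h4 : ‖∫ y, fderiv ℝ (cutoff φ k) y v • G y ∂μ - ∫ y, fderiv ℝ (cutoff φ k) y v • g y ∂μ‖ ≤
      ε / 2 / (J + 1) * J := by
    rw [← integral_sub hi2 hi1]
    refine le_trans ?_ (mul_le_mul_of_nonneg_left (hodd k) (by positivity))
    rw [← integral_const_mul]
    refine norm_integral_le_of_norm_le (hio.const_mul _) (ae_of_all _ fun y => ?_)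
    rw [← smul_sub, norm_smul, mul_comm]
    by_cases hy : G y = 0
    · have hgy : g y = 0 := by
        by_contra h
        exact hgs h hy
      rw [hy, hgy, sub_zero, norm_zero, zero_mul]
      have h5 : 0 ≤ fderiv ℝ (oddCutoff φ k) y v * θ y := by
        by_cases hyU : y ∈ U
        · exact mul_nonneg ((abs_nonneg _).trans (abs_fderiv_cutoff_le hφ k (hv y hyU).le))
            (hθ0 y)
        · rw [image_eq_zero_of_notMem_tsupport fun h => hyU (hθU h), mul_zero]
      positivity
    · have hyθ := hGθ y hy
      have hyU : y ∈ U := hθU (subset_tsupport _ (by simp [hyθ]))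
      rw [hyθ, mul_one, ← dist_eq_norm, dist_comm]
      exact mul_le_mul (hgG y).le (abs_fderiv_cutoff_le hφ k (hv y hyU).le) (norm_nonneg _)
        (by positivity)
  have h5 : ε / 2 / (J + 1) * J ≤ ε / 2 := by
    rw [div_mul_eq_mul_div, div_le_iff₀ (by positivity)]
    nlinarith
  have h6 := norm_add_le
    (∫ y, fderiv ℝ (cutoff φ k) y v • G y ∂μ - ∫ y, fderiv ℝ (cutoff φ k) y v • g y ∂μ)
    (∫ y, fderiv ℝ (cutoff φ k) y v • g y ∂μ)
  rw [sub_add_cancel] at h6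
  linarith

end Measure

/-! ### Continuous functions with singularities along hypersurfaces -/

/-- The cutoffs show that `f` is a weak solution across `φ = 0`. The Weyl lemma makes it smooth, and
the equation passes to the null level set by density. -/
lemma hyperholomorphicOn_ball_of_regular {φ : ℍ[ℝ] → ℝ} (hφ : ContDiff ℝ ∞ φ) {q v : ℍ[ℝ]} {R : ℝ}
    (hR : 0 < R) (hv : ∀ y ∈ ball q (2 * R), 0 < fderiv ℝ φ y v) {f : ℍ[ℝ] → ℍ[ℝ]}
    (hf : Continuous f) (hfc : HasCompactSupport f)
    (hfh : HyperholomorphicOn f (ball q R \ {y | φ y = 0})) :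
    HyperholomorphicOn f (ball q (R / 4)) := by
  borelize ℍ[ℝ]
  set μ : Measure ℍ[ℝ] := Measure.addHaar
  obtain ⟨K, hK⟩ := (hfc.isCompact_range hf).isBounded.exists_norm_le
  have hK : ∀ x, ‖f x‖ ≤ K := fun x => hK _ (mem_range_self x)
  have hcl : IsClosed {y | φ y = 0} := isClosed_eq hφ.continuous continuous_const
  have hnull : μ (ball q (2 * R) ∩ {y | φ y = 0}) = 0 := measure_zeros_eq_zero hφ isOpen_ball hv
  have hsub : ball q R ⊆ ball q (2 * R) := ball_subset_ball (by linarith)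
  set θ : ContDiffBump q := ⟨R, 3 * R / 2, hR, by linarith⟩
  have hθU : tsupport θ ⊆ ball q (2 * R) := by
    rw [θ.tsupport_eq]
    refine closedBall_subset_ball ?_
    change 3 * R / 2 < 2 * R
    linarith
  have hweak : ∀ Ψ : ℍ[ℝ] → ℍ[ℝ], ContDiff ℝ ∞ Ψ → HasCompactSupport Ψ →
      tsupport Ψ ⊆ ball q R → ∫ y, fueterR Ψ y * f y ∂μ = 0 := by
    intro Ψ hΨ hΨc hΨs
    refine integral_fueterR_mul_eq_zero_of_cutoff (isOpen_ball.sdiff hcl)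
      hf.aestronglyMeasurable hK hfh (cutoff φ) (contDiff_cutoff hφ) abs_cutoff_le
      (disjoint_tsupport_cutoff hφ.continuous) ?_ hΨ hΨc hΨs fun l => ?_
    · filter_upwards [compl_mem_ae_iff.2 hnull] with y hy hyR
      exact tendsto_cutoff fun h => hy ⟨hsub hyR, h⟩
    -- The gradient of the cutoff is proportional to that of `φ`. Absorbing the ratio `∂ₗφ / ∂ᵥφ`
    -- into `G` turns every coordinate derivative into the derivative along `v`, for which the limit
    -- is known.
    · set G : ℍ[ℝ] → ℍ[ℝ] := fun y =>
        (fderiv ℝ φ y (unit l) / fderiv ℝ φ y v) • (Ψ y * coef l * f y) with hGdef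
      have hGΨ : Function.support G ⊆ Function.support Ψ := fun y hy h => hy (by simp [G, h])
      have hG : Continuous G := by
        rw [← contDiff_zero (𝕜 := ℝ)]
        refine contDiff_of_tsupport_subset (isOpen_ball (x := q) (ε := R)) ?_
          ((closure_mono hGΨ).trans hΨs)
        rw [contDiffOn_zero]
        refine ContinuousOn.smul (ContinuousOn.div ?_ ?_ fun y hy => (hv y (hsub hy)).ne') ?_
        · exact (continuous_fderiv_apply_const hφ _).continuousOn
        · exact (continuous_fderiv_apply_const hφ _).continuousOn
        · exact ((hΨ.continuous.mul continuous_const).mul hf).continuousOn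
      have h := tendsto_integral_fderiv_cutoff (μ := μ) hφ isOpen_ball hv θ.contDiff
        θ.hasCompactSupport hθU (fun y => θ.nonneg) hG fun y hy => by
          refine θ.one_of_mem_closedBall ?_
          exact ball_subset_closedBall (hΨs (subset_tsupport _ (hGΨ hy)))
      refine h.congr fun k => integral_congr_ae (ae_of_all _ fun y => ?_)
      by_cases hy : y ∈ tsupport Ψ
      · have hy' := (hv y (hsub (hΨs hy))).ne'
        simp only [hGdef, smul_smul, fderiv_cutoff hφ]
        congr 1
        field_simp
      · simp [hGdef, image_eq_zero_of_notMem_tsupport hy]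
  obtain ⟨F, hF, hFf⟩ := exists_contDiffOn_of_weak hR hf.aestronglyMeasurable hK hweak
  have hsub4 : ball q (R / 4) ⊆ ball q R := ball_subset_ball (by linarith)
  refine hyperholomorphicOn_of_dense (S := ball q (2 * R) ∩ {y | φ y = 0}) isOpen_ball
    (hF.congr fun x hx => (hFf x hx hf.continuousAt).symm)
    (Measure.interior_eq_empty_of_null hnull) fun y hy => ?_
  exact hfh.2 y ⟨hsub4 hy.1, fun h => hy.2 ⟨hsub (hsub4 hy.1), h⟩⟩

/-- A continuous function that is hyperholomorphic off a smooth hypersurface is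
hyperholomorphic. -/
lemma hyperholomorphicOn_of_hypersurface {N : Set ℍ[ℝ]} (hN : IsOpen N) {φ : ℍ[ℝ] → ℝ}
    (hφ : ContDiffOn ℝ ∞ φ N) (hd : ∀ y ∈ N, φ y = 0 → fderiv ℝ φ y ≠ 0) {f : ℍ[ℝ] → ℍ[ℝ]}
    (hf : ContinuousOn f N) (hfh : HyperholomorphicOn f (N \ {y | φ y = 0})) :
    HyperholomorphicOn f N := by
  refine hyperholomorphicOn_of_locally fun q hq => ?_
  have hφq : ContDiffAt ℝ ∞ φ q := hφ.contDiffAt (hN.mem_nhds hq)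
  by_cases hq0 : φ q = 0
  · obtain ⟨v, hv⟩ : ∃ v, 0 < fderiv ℝ φ q v := by
      obtain ⟨v, hv⟩ := DFunLike.ne_iff.1 (hd q hq hq0)
      rcases lt_or_gt_of_ne hv with h | h
      · exact ⟨-v, by simpa using h⟩
      · exact ⟨v, by simpa using h⟩
    have hcont : ContinuousAt (fun y => fderiv ℝ φ y v) q :=
      ((hφ.continuousOn_fderiv_of_isOpen hN (by simp)).continuousAt
        (hN.mem_nhds hq)).clm_apply continuousAt_const
    obtain ⟨ρ, hρ, hρN⟩ := Metric.mem_nhds_iff.1 (inter_mem (hN.mem_nhds hq)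
      (continuousAt_const.eventually_lt hcont hv))
    -- Multiplying `φ` and `f` by a bump equal to `1` near `q` makes both globally defined without
    -- changing them on the ball of radius `ρ / 2`.
    set b : ContDiffBump q := ⟨ρ / 2, 3 * ρ / 4, by linarith, by linarith⟩
    have hbN : tsupport b ⊆ N := by
      rw [b.tsupport_eq]
      refine (closedBall_subset_ball ?_).trans (hρN.trans inter_subset_left)
      change 3 * ρ / 4 < ρ
      linarith
    have hb1 : ∀ y ∈ ball q (ρ / 2), b y = 1 := fun y hy =>
      b.one_of_mem_closedBall (ball_subset_closedBall hy)
    have hφ' : ContDiff ℝ ∞ fun y => b y * φ y :=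
      contDiff_of_tsupport_subset hN (b.contDiff.contDiffOn.mul hφ)
        (tsupport_mul_subset_left.trans hbN)
    have hf' : Continuous fun y => b y • f y := by
      rw [← contDiff_zero (𝕜 := ℝ)]
      refine contDiff_of_tsupport_subset hN ?_ ((tsupport_smul_subset_left _ _).trans hbN)
      rw [contDiffOn_zero]
      exact b.continuous.continuousOn.smul hf
    have h2R : 2 * (ρ / 4) = ρ / 2 := by ring
    have hsub : ball q (ρ / 4) ⊆ ball q (ρ / 2) := ball_subset_ball (by linarith)
    have key := hyperholomorphicOn_ball_of_regular (R := ρ / 4) (v := v) hφ' (by linarith)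
      (fun y hy => by
        rw [h2R] at hy
        have : (fun y => b y * φ y) =ᶠ[𝓝 y] φ := by
          filter_upwards [isOpen_ball.mem_nhds hy] with z hz
          rw [hb1 z hz, one_mul]
        rw [this.fderiv_eq]
        exact (hρN (ball_subset_ball (by linarith) hy)).2)
      hf' b.hasCompactSupport.smul_right ((hfh.mono (O' := ball q (ρ / 4) \
        {y | b y * φ y = 0}) fun y hy => ⟨(hρN (ball_subset_ball (by linarith) hy.1)).1,
          fun h => hy.2 (by
            change b y * φ y = 0
            rw [show φ y = 0 from h, mul_zero])⟩).congr
        (isOpen_ball.sdiff (isClosed_eq hφ'.continuous continuous_const)) fun y hy => by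
          simp [hb1 y (hsub hy.1)])
    refine ⟨ball q (ρ / 4 / 4), isOpen_ball, mem_ball_self (by linarith),
      key.congr isOpen_ball fun y hy => ?_⟩
    rw [hb1 y (ball_subset_ball (by linarith) hy), one_smul]
  · refine ⟨N ∩ {y | φ y ≠ 0}, ?_, ⟨hq, hq0⟩, hfh⟩
    exact hφ.continuousOn.isOpen_inter_preimage hN isOpen_ne

/-- A continuous function that is hyperholomorphic off a closed set contained in finitely many
hypersurfaces is hyperholomorphic. -/
theorem hyperholomorphicOn_of_hypersurfaces {ι : Type*} (s : Finset ι) (φ : ι → ℍ[ℝ] → ℝ)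
    {f : ℍ[ℝ] → ℍ[ℝ]} : ∀ {N T : Set ℍ[ℝ]}, IsOpen N → IsOpen (N \ T) →
    (∀ i ∈ s, ContDiffOn ℝ ∞ (φ i) N) → N ∩ T ⊆ ⋃ i ∈ s, hypersurface (φ i) →
    ContinuousOn f N → HyperholomorphicOn f (N \ T) → HyperholomorphicOn f N := by
  classical
  induction s using Finset.induction_on with
  | empty =>
    intro N T _ _ _ hT _ hf
    refine hf.mono fun y hy => ⟨hy, fun hyT => ?_⟩
    simpa using hT ⟨hy, hyT⟩
  | insert i s _ ih =>
    intro N T hN hNT hφ hT hc hf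
    have hφi : ContDiffOn ℝ ∞ (φ i) N := hφ i (Finset.mem_insert_self i s)
    have hφs : ∀ j ∈ s, ContDiffOn ℝ ∞ (φ j) N := fun j hj =>
      hφ j (Finset.mem_insert_of_mem hj)
    have hN₁ : IsOpen (N \ {y | φ i y = 0}) :=
      hφi.continuousOn.isOpen_inter_preimage hN isOpen_ne
    have hT' : ∀ y ∈ N ∩ T, y ∈ hypersurface (φ i) ∨ y ∈ ⋃ j ∈ s, hypersurface (φ j) :=
      fun y hy => by
        have := hT hy
        rw [Finset.set_biUnion_insert] at this
        exact this
    -- off the zeros of `φ i` there is one hypersurface less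
    have h₁ : HyperholomorphicOn f (N \ {y | φ i y = 0}) := by
      refine ih (T := T) hN₁ ?_ (fun j hj => (hφs j hj).mono sdiff_subset) ?_
        (hc.mono sdiff_subset) (hf.mono (sdiff_subset_sdiff_left sdiff_subset))
      · rw [show (N \ {y | φ i y = 0}) \ T = (N \ {y | φ i y = 0}) ∩ (N \ T) by
          ext y; simp only [Set.mem_sdiff, mem_inter_iff]; tauto]
        exact hN₁.inter hNT
      · rintro y ⟨hy, hyT⟩
        exact (hT' y ⟨hy.1, hyT⟩).resolve_left fun h => hy.2 h.1
    -- at the regular points of `φ i`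
    have hN₂ : IsOpen (N ∩ {y | fderiv ℝ (φ i) y ≠ 0}) :=
      (hφi.continuousOn_fderiv_of_isOpen hN (by simp)).isOpen_inter_preimage hN isOpen_ne
    have h₂ : HyperholomorphicOn f (N ∩ {y | fderiv ℝ (φ i) y ≠ 0}) :=
      hyperholomorphicOn_of_hypersurface hN₂ (hφi.mono inter_subset_left) (fun y hy _ => hy.2)
        (hc.mono inter_subset_left) (h₁.mono (sdiff_subset_sdiff_left inter_subset_left))
    have hU : HyperholomorphicOn f ((N \ {y | φ i y = 0}) ∪
        (N ∩ {y | fderiv ℝ (φ i) y ≠ 0}) ∪ (N \ T)) := by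
      refine hyperholomorphicOn_of_locally fun y hy => ?_
      rcases hy with (hy | hy) | hy
      exacts [⟨_, hN₁, hy, h₁⟩, ⟨_, hN₂, hy, h₂⟩, ⟨_, hNT, hy, hf⟩]
    have hset : N \ (T ∩ {y | φ i y = 0 ∧ fderiv ℝ (φ i) y = 0}) =
        (N \ {y | φ i y = 0}) ∪ (N ∩ {y | fderiv ℝ (φ i) y ≠ 0}) ∪ (N \ T) := by
      ext y
      simp only [Set.mem_sdiff, mem_inter_iff, mem_union, mem_ofPred_eq]
      tauto
    -- What is left of `T` consists of critical zeros of `φ i`. They are not on its hypersurface, so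
    -- the others cover them and induction applies again. This set is closed only relative to `N`,
    -- which is why the induction assumes `N \ T` open rather than `T` closed.
    refine ih (T := T ∩ {y | φ i y = 0 ∧ fderiv ℝ (φ i) y = 0}) hN ?_ hφs ?_ hc (by rwa [hset])
    · rw [hset]
      exact (hN₁.union hN₂).union hNT
    · rintro y ⟨hy, hyT, hy'⟩
      exact (hT' y ⟨hy, hyT⟩).resolve_left fun h => h.2 hy'.2

/-- A finite union of hypersurfaces contains no nonempty open set. -/
theorem eq_empty_of_subset_hypersurfaces {ι : Type*} (s : Finset ι) (φ : ι → ℍ[ℝ] → ℝ) :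
    ∀ {N : Set ℍ[ℝ]}, IsOpen N → (∀ i ∈ s, ContDiffOn ℝ ∞ (φ i) N) →
      N ⊆ ⋃ i ∈ s, hypersurface (φ i) → N = ∅ := by
  classical
  induction s using Finset.induction_on with
  | empty =>
    intro N _ _ h
    simpa using h
  | insert i s _ ih =>
    intro N hN hφ h
    have hφi : ContDiffOn ℝ ∞ (φ i) N := hφ i (Finset.mem_insert_self i s)
    have hφs : ∀ j ∈ s, ContDiffOn ℝ ∞ (φ j) N := fun j hj =>
      hφ j (Finset.mem_insert_of_mem hj)
    rw [Finset.set_biUnion_insert] at h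
    have h₁ : N \ {y | φ i y = 0} = ∅ :=
      ih (hφi.continuousOn.isOpen_inter_preimage hN isOpen_ne)
        (fun j hj => (hφs j hj).mono sdiff_subset)
        fun y hy => (h hy.1).resolve_left fun h => hy.2 h.1
    have h0 : ∀ y ∈ N, φ i y = 0 := fun y hy => by
      by_contra hne
      have : y ∈ N \ {y | φ i y = 0} := ⟨hy, hne⟩
      simp [h₁] at this
    refine ih hN hφs fun y hy => (h hy).resolve_left fun hy' => hy'.2 ?_
    have : φ i =ᶠ[𝓝 y] fun _ => 0 := by
      filter_upwards [hN.mem_nhds hy] with z hz using h0 z hz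
    rw [this.fderiv_eq]
    simp

/-! ### Thin sets -/

/-- `T` is closed and, over `N`, contained in finitely many smooth hypersurfaces. -/
def Thin (N T : Set ℍ[ℝ]) : Prop :=
  IsClosed T ∧ ∃ (m : ℕ) (φ : Fin m → ℍ[ℝ] → ℝ), (∀ i, ContDiffOn ℝ ∞ (φ i) N) ∧
    N ∩ T ⊆ ⋃ i, hypersurface (φ i)

lemma Thin.mono {N N' T : Set ℍ[ℝ]} (h : Thin N T) (hN : N' ⊆ N) : Thin N' T := by
  obtain ⟨hT, m, φ, hφ, hφT⟩ := h
  exact ⟨hT, m, φ, fun i => (hφ i).mono hN, (inter_subset_inter_left _ hN).trans hφT⟩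

lemma Thin.union {N T T' : Set ℍ[ℝ]} (h : Thin N T) (h' : Thin N T') : Thin N (T ∪ T') := by
  obtain ⟨hT, m, φ, hφ, hφT⟩ := h
  obtain ⟨hT', m', φ', hφ', hφT'⟩ := h'
  refine ⟨hT.union hT', m + m', Fin.append φ φ', fun i => ?_, ?_⟩
  · refine Fin.addCases (fun i => ?_) (fun i => ?_) i
    · simpa using hφ i
    · simpa using hφ' i
  · rintro y ⟨hyN, hy | hy⟩
    · obtain ⟨i, hi⟩ := mem_iUnion.1 (hφT ⟨hyN, hy⟩)
      exact mem_iUnion.2 ⟨Fin.castAdd m' i, by simpa using hi⟩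
    · obtain ⟨i, hi⟩ := mem_iUnion.1 (hφT' ⟨hyN, hy⟩)
      exact mem_iUnion.2 ⟨Fin.natAdd m i, by simpa using hi⟩

/-- The point lies on the real hyperplane of quaternions with the same real part as `a`. -/
lemma thin_singleton (N : Set ℍ[ℝ]) (a : ℍ[ℝ]) : Thin N {a} := by
  have h : ∀ y, HasFDerivAt (fun y : ℍ[ℝ] => inner ℝ 1 y - inner ℝ 1 a)
      (innerSL ℝ (1 : ℍ[ℝ])) y := fun y => (innerSL ℝ (1 : ℍ[ℝ])).hasFDerivAt.sub_const _
  refine ⟨isClosed_singleton, 1, fun _ y => inner ℝ 1 y - inner ℝ 1 a, fun _ => ?_, ?_⟩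
  · exact ((innerSL ℝ (1 : ℍ[ℝ])).contDiff.sub contDiff_const).contDiffOn
  · rintro y ⟨-, rfl⟩
    refine mem_iUnion.2 ⟨0, sub_self _, ?_⟩
    rw [(h y).fderiv]
    intro h0
    have := congrArg (fun u : ℍ[ℝ] →L[ℝ] ℝ => u 1) h0
    simp at this

lemma Thin.eq_empty_of_subset {N T W : Set ℍ[ℝ]} (h : Thin N T) (hW : IsOpen W) (hWN : W ⊆ N)
    (hWT : W ⊆ T) : W = ∅ := by
  obtain ⟨-, m, φ, hφ, hφT⟩ := h
  refine eq_empty_of_subset_hypersurfaces Finset.univ φ hW (fun i _ => (hφ i).mono hWN) ?_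
  simpa using (subset_inter hWN hWT).trans hφT

lemma weaklyHypermeromorphicOn_iff {f : ℍ[ℝ] → ℍ[ℝ]} {U : Set ℍ[ℝ]} :
    WeaklyHypermeromorphicOn f U ↔ ∀ q ∈ U, ∃ N T : Set ℍ[ℝ], IsOpen N ∧ q ∈ N ∧ N ⊆ U ∧
      Thin N T ∧ HyperholomorphicOn f (N \ T) ∧
      HyperholomorphicOn (fun p => (f p)⁻¹) ((N \ T) ∩ {p | f p ≠ 0}) := by
  constructor
  · intro h q hq
    obtain ⟨N, T, m, φ, h1, h2, h3, h4, h5, h6, h7, h8⟩ := h q hq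
    exact ⟨N, T, h1, h2, h3, ⟨h4, m, φ, h5, h6⟩, h7, h8⟩
  · intro h q hq
    obtain ⟨N, T, h1, h2, h3, ⟨h4, m, φ, h5, h6⟩, h7, h8⟩ := h q hq
    exact ⟨N, T, m, φ, h1, h2, h3, h4, h5, h6, h7, h8⟩

/-- Thin sets have empty interior, so for a smooth function the equation extends across them by
continuity of its derivatives. -/
lemma hyperholomorphicOn_of_thin {u : ℍ[ℝ] → ℍ[ℝ]} {V : Set ℍ[ℝ]} (hV : IsOpen V)
    (hu : ContDiffOn ℝ ∞ u V)
    (h : ∀ y ∈ V, ∃ N T, IsOpen N ∧ y ∈ N ∧ Thin N T ∧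
      ∀ z ∈ V ∩ (N \ T), cauchyFueter u z = 0) : HyperholomorphicOn u V := by
  refine hyperholomorphicOn_of_dense (S := V ∩ {y | cauchyFueter u y ≠ 0}) hV hu ?_
    fun y hy => by_contra fun h0 => hy.2 ⟨hy.1, h0⟩
  rw [eq_empty_iff_forall_notMem]
  intro y hy
  obtain ⟨N, T, hN, hyN, hT, h0⟩ := h y (interior_subset hy).1
  have := hT.eq_empty_of_subset (isOpen_interior.inter hN) inter_subset_right fun z hz => by
    by_contra hzT
    have hz' : z ∈ V ∩ {y | cauchyFueter u y ≠ 0} := interior_subset hz.1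
    exact hz'.2 (h0 z ⟨hz'.1, hz.2, hzT⟩)
  exact eq_empty_iff_forall_notMem.1 this y ⟨hy, hyN⟩

/-! ### Consequences of maximality -/

section Sheaf

variable {M : Opens ℍ[ℝ] → Subring (ℍ[ℝ] → ℍ[ℝ])}

/-- The functions that, off thin sets, are smooth and agree locally with sections of `M`. -/
def AlmostMem (M : Opens ℍ[ℝ] → Subring (ℍ[ℝ] → ℍ[ℝ])) (U : Opens ℍ[ℝ]) (f : ℍ[ℝ] → ℍ[ℝ]) :
    Prop :=
  ∀ q ∈ U, ∃ (N V : Opens ℍ[ℝ]) (T : Set ℍ[ℝ]), q ∈ N ∧ N ≤ U ∧ Thin N T ∧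
    (V : Set ℍ[ℝ]) = (N : Set ℍ[ℝ]) \ T ∧ ContDiffOn ℝ ∞ f V ∧ ∃ g ∈ M V, EqOn f g V

lemma AlmostMem.of_mem (hM : IsRingSheaf M) {U : Opens ℍ[ℝ]} {f : ℍ[ℝ] → ℍ[ℝ]} (hf : f ∈ M U) :
    AlmostMem M U f := by
  intro q hq
  obtain ⟨N, T, hN, hqN, hNU, hT, hfh, -⟩ :=
    weaklyHypermeromorphicOn_iff.1 (hM.weaklyHypermeromorphic U f hf) q hq
  exact ⟨⟨N, hN⟩, ⟨N \ T, hN.sdiff hT.1⟩, T, hqN, hNU, hT, rfl, hfh.1, f,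
    hM.restrict U _ (sdiff_subset.trans hNU) f hf, eqOn_refl _ _⟩

lemma AlmostMem.binary (hM : IsRingSheaf M) {U : Opens ℍ[ℝ]} {f₁ f₂ : ℍ[ℝ] → ℍ[ℝ]}
    (h₁ : AlmostMem M U f₁) (h₂ : AlmostMem M U f₂)
    (op : (ℍ[ℝ] → ℍ[ℝ]) → (ℍ[ℝ] → ℍ[ℝ]) → ℍ[ℝ] → ℍ[ℝ])
    (hop : ∀ V : Opens ℍ[ℝ], ∀ g₁ ∈ M V, ∀ g₂ ∈ M V, op g₁ g₂ ∈ M V)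
    (hsm : ∀ V : Set ℍ[ℝ], ContDiffOn ℝ ∞ f₁ V → ContDiffOn ℝ ∞ f₂ V →
      ContDiffOn ℝ ∞ (op f₁ f₂) V)
    (hcongr : ∀ (V : Set ℍ[ℝ]) g₁ g₂, EqOn f₁ g₁ V → EqOn f₂ g₂ V →
      EqOn (op f₁ f₂) (op g₁ g₂) V) : AlmostMem M U (op f₁ f₂) := by
  intro q hq
  obtain ⟨N₁, V₁, T₁, hq₁, hN₁, hT₁, hV₁, hs₁, g₁, hg₁, he₁⟩ := h₁ q hq
  obtain ⟨N₂, V₂, T₂, hq₂, hN₂, hT₂, hV₂, hs₂, g₂, hg₂, he₂⟩ := h₂ q hq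
  refine ⟨N₁ ⊓ N₂, V₁ ⊓ V₂, T₁ ∪ T₂, ⟨hq₁, hq₂⟩, inf_le_left.trans hN₁,
    (hT₁.mono inter_subset_left).union (hT₂.mono inter_subset_right), ?_,
    hsm _ (hs₁.mono inter_subset_left) (hs₂.mono inter_subset_right), op g₁ g₂,
    hop _ _ (hM.restrict _ _ inf_le_left _ hg₁) _ (hM.restrict _ _ inf_le_right _ hg₂),
    hcongr _ _ _ (he₁.mono inter_subset_left) (he₂.mono inter_subset_right)⟩
  rw [Opens.coe_inf, Opens.coe_inf, hV₁, hV₂]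
  ext y
  simp only [mem_inter_iff, Set.mem_sdiff, mem_union]
  tauto

/-- The ring of functions that are almost sections of `M`. -/
def almostSubring (hM : IsRingSheaf M) (U : Opens ℍ[ℝ]) : Subring (ℍ[ℝ] → ℍ[ℝ]) where
  carrier := {f | AlmostMem M U f}
  mul_mem' h₁ h₂ := h₁.binary hM h₂ (· * ·) (fun _ _ h _ h' => mul_mem h h')
    (fun _ h h' => h.mul h') (fun _ _ _ h h' _ hy => congrArg₂ (· * ·) (h hy) (h' hy))
  add_mem' h₁ h₂ := h₁.binary hM h₂ (· + ·) (fun _ _ h _ h' => add_mem h h')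
    (fun _ h h' => h.add h') (fun _ _ _ h h' _ hy => congrArg₂ (· + ·) (h hy) (h' hy))
  one_mem' := .of_mem hM (one_mem _)
  zero_mem' := .of_mem hM (zero_mem _)
  neg_mem' h := h.binary hM h (fun f _ => -f) (fun _ _ h _ _ => neg_mem h)
    (fun _ h _ => h.neg) (fun _ _ _ h _ _ hy => congrArg (- ·) (h hy))

lemma contDiffAt_quaternion_inv {q : ℍ[ℝ]} (hq : q ≠ 0) :
    ContDiffAt ℝ ∞ (fun p : ℍ[ℝ] => p⁻¹) q := by
  have h := contDiffAt_ringInverse (n := ∞) ℝ (Units.mk0 q hq)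
  simpa [Ring.inverse_eq_inv'] using h

/-- The exceptional sets of the local section `g` may accumulate at `T` and so fail to lie in
finitely many hypersurfaces. The smoothness demanded in `AlmostMem` removes them: `f`, and `f⁻¹`
where `f ≠ 0`, satisfy the equation on all of `N \ T`, and `T` alone is exceptional. -/
lemma isRingSheaf_almostSubring (hM : IsRingSheaf M) : IsRingSheaf (almostSubring hM) where
  weaklyHypermeromorphic U f hf := by
    refine weaklyHypermeromorphicOn_iff.2 fun q hq => ?_
    obtain ⟨N, V, T, hqN, hNU, hT, hV, hs, g, hg, he⟩ := hf q hq
    have hloc := weaklyHypermeromorphicOn_iff.1 (hM.weaklyHypermeromorphic V g hg)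
    have hne : IsOpen (V ∩ {p | f p ≠ 0}) :=
      hs.continuousOn.isOpen_inter_preimage V.isOpen isOpen_ne
    refine ⟨N, T, N.isOpen, hqN, hNU, hT, ?_, ?_⟩ <;> rw [← hV]
    · refine hyperholomorphicOn_of_thin V.isOpen hs fun y hy => ?_
      obtain ⟨N', T', hN', hyN', -, hT', hgh, -⟩ := hloc y hy
      refine ⟨N', T', hN', hyN', hT', fun z hz => ?_⟩
      rw [cauchyFueter_eq_zero_iff, fueterL_congr (he.eventuallyEq_of_mem (V.isOpen.mem_nhds hz.1))]
      exact hgh.fueterL_eq_zero hz.2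
    · refine hyperholomorphicOn_of_thin hne (fun y hy => ?_) fun y hy => ?_
      · exact ((contDiffAt_quaternion_inv hy.2).comp y
          (hs.contDiffAt (V.isOpen.mem_nhds hy.1))).contDiffWithinAt
      · obtain ⟨N', T', hN', hyN', -, hT', -, hgh⟩ := hloc y hy.1
        refine ⟨N', T', hN', hyN', hT', fun z hz => ?_⟩
        have hfg : (fun p => (f p)⁻¹) =ᶠ[𝓝 z] fun p => (g p)⁻¹ := by
          filter_upwards [V.isOpen.mem_nhds hz.1.1] with w hw
          rw [he hw]
        rw [cauchyFueter_eq_zero_iff, fueterL_congr hfg]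
        refine hgh.fueterL_eq_zero ⟨hz.2, ?_⟩
        change g z ≠ 0
        rw [← he hz.1.1]
        exact hz.1.2
  restrict U W hWU f hf q hq := by
    obtain ⟨N, V, T, hqN, hNU, hT, hV, hs, g, hg, he⟩ := hf q (hWU hq)
    refine ⟨N ⊓ W, V ⊓ W, T, ⟨hqN, hq⟩, inf_le_right, hT.mono inter_subset_left, ?_,
      hs.mono inter_subset_left, g, hM.restrict _ _ inf_le_left _ hg, he.mono inter_subset_left⟩
    rw [Opens.coe_inf, Opens.coe_inf, hV]
    ext y
    simp only [mem_inter_iff, Set.mem_sdiff]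
    tauto
  isLocal U f h q hq := by
    obtain ⟨W, hqW, hWU, hf⟩ := h q hq
    obtain ⟨N, V, T, hqN, hNW, h'⟩ := hf q hqW
    exact ⟨N, V, T, hqN, hNW.trans hWU, h'⟩

lemma IsHypermeromorphicSheaf.mem_of_almostMem (hM : IsHypermeromorphicSheaf M)
    {U : Opens ℍ[ℝ]} {f : ℍ[ℝ] → ℍ[ℝ]} (hf : AlmostMem M U f) : f ∈ M U :=
  hM.le_of_ge (isRingSheaf_almostSubring hM.prop)
    (fun _ _ hg => AlmostMem.of_mem hM.prop hg) U hf

/-- Sections are represented by functions on all of `ℍ`. Maximality guarantees that membership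
ignores the values outside `U`. -/
lemma IsHypermeromorphicSheaf.mem_congr (hM : IsHypermeromorphicSheaf M)
    {U : Opens ℍ[ℝ]} {f g : ℍ[ℝ] → ℍ[ℝ]} (hf : f ∈ M U) (h : EqOn g f U) : g ∈ M U := by
  refine hM.mem_of_almostMem fun q hq => ?_
  obtain ⟨N, V, T, hqN, hNU, hT, hV, hs, g', hg', he⟩ := AlmostMem.of_mem hM.prop hf q hq
  have hVU : EqOn g f V := h.mono fun y hy => by
    rw [hV] at hy
    exact hNU hy.1
  exact ⟨N, V, T, hqN, hNU, hT, hV, hs.congr hVU, g', hg', hVU.trans he⟩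

/-- A section of `M` over a punctured open set that is smooth there is a section over the whole
set. -/
lemma IsHypermeromorphicSheaf.mem_of_puncture (hM : IsHypermeromorphicSheaf M)
    {U V : Opens ℍ[ℝ]} {a : ℍ[ℝ]} {f : ℍ[ℝ] → ℍ[ℝ]} (hV : (V : Set ℍ[ℝ]) = (U : Set ℍ[ℝ]) \ {a})
    (hf : f ∈ M V) (hs : ContDiffOn ℝ ∞ f V) : f ∈ M U :=
  hM.mem_of_almostMem fun _ hq =>
    ⟨U, V, {a}, hq, le_rfl, thin_singleton _ _, hV, hs, f, hf, eqOn_refl _ _⟩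

/-- A continuous weakly hypermeromorphic function is hyperholomorphic. -/
theorem WeaklyHypermeromorphicOn.hyperholomorphicOn {f : ℍ[ℝ] → ℍ[ℝ]} {U : Set ℍ[ℝ]}
    (h : WeaklyHypermeromorphicOn f U) (hc : ContinuousOn f U) : HyperholomorphicOn f U := by
  refine hyperholomorphicOn_of_locally fun q hq => ?_
  obtain ⟨N, T, m, φ, hN, hqN, hNU, hT, hφ, hφT, hf, -⟩ := h q hq
  exact ⟨N, hN, hqN, hyperholomorphicOn_of_hypersurfaces Finset.univ φ hN (hN.sdiff hT)
    (fun i _ => hφ i) (by simpa using hφT) (hc.mono hNU) hf⟩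

end Sheaf

/-! ### Coefficients and roots of quaternionic polynomials -/

section Polynomials

open Polynomial

/-- The product `(T - g₁) ⋯ (T - gₙ)`, with `T` central. -/
noncomputable def rootProd {R : Type*} [Ring R] (l : List R) : Polynomial R :=
  (l.map fun g => X - C g).prod

lemma rootProd_cons {R : Type*} [Ring R] (g : R) (l : List R) :
    rootProd (g :: l) = (X - C g) * rootProd l := rfl

lemma coeff_zero_rootProd_cons {R : Type*} [Ring R] (g : R) (l : List R) :
    (rootProd (g :: l)).coeff 0 = -(g * (rootProd l).coeff 0) := by
  simp [rootProd_cons, sub_mul]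

lemma coeff_succ_rootProd_cons {R : Type*} [Ring R] (g : R) (l : List R) (k : ℕ) :
    (rootProd (g :: l)).coeff (k + 1) = (rootProd l).coeff k - g * (rootProd l).coeff (k + 1) := by
  simp [rootProd_cons, sub_mul, coeff_X_mul]

lemma monic_rootProd {R : Type*} [Ring R] (l : List R) : (rootProd l).Monic := by
  induction l with
  | nil => exact monic_one
  | cons g l ih => exact (monic_X_sub_C g).mul ih

lemma natDegree_rootProd {R : Type*} [Ring R] [Nontrivial R] (l : List R) :
    (rootProd l).natDegree = l.length := by
  induction l with
  | nil => exact natDegree_one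
  | cons g l ih =>
    rw [rootProd_cons, (monic_X_sub_C g).natDegree_mul (monic_rootProd l), ih, natDegree_X_sub_C,
      List.length_cons, add_comm]

/-- The recursion for the coefficients uses ring operations only. Hyperholomorphy alone is not
preserved by products, so the ring structure of `M` is essential. -/
lemma coeff_rootProd_mem {ι R : Type*} [Ring R] (S : Subring (ι → R)) (l : List (ι → R))
    (hl : ∀ g ∈ l, g ∈ S) (k : ℕ) :
    (fun x => (rootProd (l.map fun g => g x)).coeff k) ∈ S := by
  induction l generalizing k with
  | nil =>
    rcases eq_or_ne k 0 with rfl | hk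
    · have h : (fun x => (rootProd (([] : List (ι → R)).map fun g => g x)).coeff 0) = 1 := by
        funext x; simp [rootProd]
      rw [h]; exact S.one_mem
    · have h : (fun x => (rootProd (([] : List (ι → R)).map fun g => g x)).coeff k) = 0 := by
        funext x; simp [rootProd, coeff_one, hk]
      rw [h]; exact S.zero_mem
  | cons g l ih =>
    have hg := hl g List.mem_cons_self
    have ih := ih fun g hg => hl g (List.mem_cons_of_mem _ hg)
    cases k with
    | zero =>
      simp only [List.map_cons, coeff_zero_rootProd_cons]
      exact S.neg_mem (S.mul_mem hg (ih 0))
    | succ k =>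
      simp only [List.map_cons, coeff_succ_rootProd_cons]
      exact S.sub_mem (ih k) (S.mul_mem hg (ih (k + 1)))

lemma norm_coeff_rootProd_le {K : ℝ} (hK : 0 ≤ K) (l : List ℍ[ℝ]) (hl : ∀ g ∈ l, ‖g‖ ≤ K) (k : ℕ) :
    ‖(rootProd l).coeff k‖ ≤ (K + 1) ^ l.length := by
  induction l generalizing k with
  | nil =>
    simp only [rootProd, List.map_nil, List.prod_nil, coeff_one, List.length_nil, pow_zero]
    split_ifs <;> simp
  | cons g l ih =>
    have hg := hl g List.mem_cons_self
    have ih := ih fun g hg => hl g (List.mem_cons_of_mem _ hg)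
    have hpos : 0 ≤ (K + 1) ^ l.length := by positivity
    have hgQ : ∀ k, ‖g * (rootProd l).coeff k‖ ≤ K * (K + 1) ^ l.length := fun k => by
      rw [norm_mul]
      exact mul_le_mul hg (ih k) (norm_nonneg _) hK
    rw [List.length_cons, pow_succ]
    cases k with
    | zero =>
      rw [coeff_zero_rootProd_cons, norm_neg]
      linarith [hgQ 0]
    | succ k =>
      rw [coeff_succ_rootProd_cons]
      linarith [norm_sub_le ((rootProd l).coeff k) (g * (rootProd l).coeff (k + 1)), ih k,
        hgQ (k + 1)]

/-- Write `P = (T - g) Q`, so that `q_k = p_{k+1} + g q_{k+1}` and `q_n = 1`. If `‖g‖ > K + 1`,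
descending from `q_n` gives `‖q_k‖ ≥ 1` for all `k ≤ n`, whence `‖p_0‖ = ‖g‖ ‖q_0‖ > K`, a
contradiction. With `g` bounded, the same recursion bounds the coefficients of `Q`. The factors do
not commute, so they are peeled off from the left one at a time. -/
lemma exists_forall_norm_le_of_norm_coeff_rootProd_le (n : ℕ) {K : ℝ} (hK : 0 ≤ K) :
    ∃ K' : ℝ, ∀ l : List ℍ[ℝ], l.length = n → (∀ k, ‖(rootProd l).coeff k‖ ≤ K) →
      ∀ g ∈ l, ‖g‖ ≤ K' := by
  induction n generalizing K with
  | zero =>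
    refine ⟨0, fun l hl _ g hg => ?_⟩
    simp [List.length_eq_zero_iff.1 hl] at hg
  | succ n ih =>
    obtain ⟨K', hK'⟩ := ih (K := (2 * K + 1) ^ n) (by positivity)
    refine ⟨max (K + 1) K', fun l hl hP => ?_⟩
    obtain ⟨g, t, rfl⟩ := List.exists_cons_of_length_eq_add_one hl
    have ht : t.length = n := by simpa using hl
    have htop : (rootProd t).coeff n = 1 := by
      have := (monic_rootProd t).coeff_natDegree
      rwa [natDegree_rootProd, ht] at this
    have hrec : ∀ k, (rootProd t).coeff k =
        (rootProd (g :: t)).coeff (k + 1) + g * (rootProd t).coeff (k + 1) := fun k => by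
      rw [coeff_succ_rootProd_cons]; abel
    have hg : ‖g‖ ≤ K + 1 := by
      by_contra! hg
      have hge : ∀ i k, k + i = n → 1 ≤ ‖(rootProd t).coeff k‖ := by
        intro i
        induction i with
        | zero => rintro k rfl; rw [add_zero] at htop; simp [htop]
        | succ i ihi =>
          intro k hk
          have h1 := ihi (k + 1) (by omega)
          have h2 := norm_sub_norm_le (g * (rootProd t).coeff (k + 1))
            (-(rootProd (g :: t)).coeff (k + 1))
          rw [sub_neg_eq_add, add_comm (g * _), ← hrec k, norm_neg, norm_mul] at h2
          have h3 := hP (k + 1)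
          nlinarith
      have h1 := hge n 0 (by simp)
      have h2 := hP 0
      rw [coeff_zero_rootProd_cons, norm_neg, norm_mul] at h2
      nlinarith
    -- Each descent turns a bound `b ≥ 1` into at most `K + (K + 1) * b ≤ (2 * K + 1) * b`.
    have hle : ∀ i k, k + i = n → ‖(rootProd t).coeff k‖ ≤ (2 * K + 1) ^ i := by
      intro i
      induction i with
      | zero => rintro k rfl; rw [add_zero] at htop; simp [htop]
      | succ i ihi =>
        intro k hk
        have h1 := ihi (k + 1) (by omega)
        have h2 : ‖g * (rootProd t).coeff (k + 1)‖ ≤ (K + 1) * (2 * K + 1) ^ i := by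
          rw [norm_mul]
          exact mul_le_mul hg h1 (norm_nonneg _) (by linarith)
        have h3 : 1 ≤ (2 * K + 1) ^ i := one_le_pow₀ (by linarith)
        rw [hrec k, pow_succ]
        have h4 := norm_add_le ((rootProd (g :: t)).coeff (k + 1)) (g * (rootProd t).coeff (k + 1))
        have h5 := hP (k + 1)
        nlinarith
    have hQ : ∀ k, ‖(rootProd t).coeff k‖ ≤ (2 * K + 1) ^ n := by
      intro k
      rcases le_or_gt k n with hk | hk
      · exact (hle (n - k) k (by omega)).trans
          (pow_le_pow_right₀ (by linarith) (Nat.sub_le _ _))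
      · rw [coeff_eq_zero_of_natDegree_lt (by rwa [natDegree_rootProd, ht]), norm_zero]
        positivity
    intro u hu
    rcases List.mem_cons.1 hu with rfl | hu
    · exact hg.trans (le_max_left _ _)
    · exact (hK' t ht hQ u hu).trans (le_max_right _ _)

lemma coeff_eq_of_eq_sum {n : ℕ} {P : Polynomial ℍ[ℝ]} {c : Fin n → ℍ[ℝ]}
    (h : P = X ^ n + ∑ j : Fin n, C (c j) * X ^ (n - 1 - (j : ℕ))) (j : Fin n) :
    c j = P.coeff (n - 1 - j) := by
  have hj := j.isLt
  rw [h, coeff_add, coeff_X_pow, if_neg (by omega), zero_add, finsetSum_coeff,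
    Finset.sum_eq_single j]
  · simp
  · intro i _ hij
    rw [coeff_C_mul, coeff_X_pow, if_neg, mul_zero]
    intro h'
    have := i.isLt
    exact hij (Fin.ext (by omega))
  · simp

lemma norm_coeff_le_of_eq_sum {n : ℕ} {P : Polynomial ℍ[ℝ]} {c : Fin n → ℍ[ℝ]}
    (h : P = X ^ n + ∑ j : Fin n, C (c j) * X ^ (n - 1 - (j : ℕ))) (k : ℕ) :
    ‖P.coeff k‖ ≤ 1 + ∑ j, ‖c j‖ := by
  rw [h, coeff_add, finsetSum_coeff]
  refine (norm_add_le _ _).trans (add_le_add ?_ ((norm_sum_le _ _).trans ?_))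
  · rw [coeff_X_pow]
    split_ifs <;> simp
  · refine Finset.sum_le_sum fun j _ => ?_
    rw [coeff_C_mul, coeff_X_pow]
    split_ifs <;> simp

end Polynomials

/-! ### Hypermeromorphic functions on manifolds -/

section Manifold

variable {M : Opens ℍ[ℝ] → Subring (ℍ[ℝ] → ℍ[ℝ])}
variable {X : Type*} [TopologicalSpace X]

lemma chartImage_mono (h : OpenPartialHomeomorph X ℍ[ℝ]) {W W' : Opens X} (hW : W ≤ W') :
    chartImage h W ≤ chartImage h W' := fun _ hy => ⟨hy.1, hW hy.2⟩

lemma continuousOn_comp_chart_symm {h : OpenPartialHomeomorph X ℍ[ℝ]} {W : Opens X} {g : X → ℍ[ℝ]}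
    (hg : ContinuousOn g W) : ContinuousOn (g ∘ h.symm) (chartImage h W) :=
  hg.comp (h.continuousOn_symm.mono fun _ hy => hy.1) fun _ hy => hy.2

/-- A manifold modelled on `ℍ` has no isolated points, so limits at punctures are unique and
`limUnder` computes them. -/
lemma nhdsNE_neBot_of_chart (h : OpenPartialHomeomorph X ℍ[ℝ]) {s : X} (hs : s ∈ h.source) :
    (𝓝[≠] s).NeBot := by
  have ht : Tendsto h.symm (𝓝[≠] (h s)) (𝓝[≠] s) := by
    refine tendsto_nhdsWithin_iff.2 ⟨?_, ?_⟩
    · have := (h.continuousAt_symm (h.map_source hs)).tendsto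
      rw [h.left_inv hs] at this
      exact this.mono_left nhdsWithin_le_nhds
    · filter_upwards [self_mem_nhdsWithin, mem_nhdsWithin_of_mem_nhds
        (h.open_target.mem_nhds (h.map_source hs))] with y hy hyt hys
      exact hy (by rw [← h.right_inv hyt, show h.symm y = s from hys]; rfl)
  exact ht.neBot

lemma eventually_nhdsNE_notMem_of_isDiscrete {Z : Type*} [TopologicalSpace Z] {A : Set Z}
    (hA : IsDiscrete A) {a : Z} (ha : a ∈ A) : ∀ᶠ x in 𝓝[≠] a, x ∉ A := by
  have := hA.to_subtype
  obtain ⟨U, hU, hUA⟩ := isOpen_induced_iff.1 (isOpen_discrete ({⟨a, ha⟩} : Set A))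
  have haU : a ∈ U := by
    have : (⟨a, ha⟩ : A) ∈ Subtype.val ⁻¹' U := by rw [hUA]; rfl
    exact this
  filter_upwards [self_mem_nhdsWithin, mem_nhdsWithin_of_mem_nhds (hU.mem_nhds haU)]
    with x hx hxU hxA
  have : (⟨x, hxA⟩ : A) ∈ ({⟨a, ha⟩} : Set A) := by rw [← hUA]; exact hxU
  exact hx (congrArg Subtype.val this)

variable [ChartedSpace ℍ[ℝ] X]

/-- Hypermeromorphic functions are continuous by definition, so they have no poles. -/
theorem pseudoholomorphicOn_iff (hM : IsHypermeromorphicSheaf M) {g : X → ℍ[ℝ]} {W : Opens X} :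
    PseudoholomorphicOn M g W ↔ HypermeromorphicOn M g W :=
  ⟨fun h => ⟨h.1, fun e he => (h.2 e he).1⟩, fun h => ⟨h.1, fun e he => ⟨h.2 e he,
    (hM.prop.weaklyHypermeromorphic _ _ (h.2 e he)).hyperholomorphicOn
      (continuousOn_comp_chart_symm h.1)⟩⟩⟩

/-- The ring of hypermeromorphic functions on `W`. -/
def hypermeromorphicSubring (M : Opens ℍ[ℝ] → Subring (ℍ[ℝ] → ℍ[ℝ])) (W : Opens X) :
    Subring (X → ℍ[ℝ]) where
  carrier := {g | HypermeromorphicOn M g W}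
  mul_mem' h h' := ⟨h.1.mul h'.1, fun e he => (M _).mul_mem (h.2 e he) (h'.2 e he)⟩
  add_mem' h h' := ⟨h.1.add h'.1, fun e he => (M _).add_mem (h.2 e he) (h'.2 e he)⟩
  one_mem' := ⟨continuousOn_const, fun _ _ => (M _).one_mem⟩
  zero_mem' := ⟨continuousOn_const, fun _ _ => (M _).zero_mem⟩
  neg_mem' h := ⟨h.1.neg, fun e he => (M _).neg_mem (h.2 e he)⟩

lemma HypermeromorphicOn.congr (hM : IsHypermeromorphicSheaf M) {g g' : X → ℍ[ℝ]} {W : Opens X}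
    (h : HypermeromorphicOn M g W) (hg : EqOn g' g W) : HypermeromorphicOn M g' W :=
  ⟨h.1.congr hg, fun e he => hM.mem_congr (h.2 e he) fun _ hy => hg hy.2⟩

lemma hypermeromorphicOn_of_locally (hM : IsHypermeromorphicSheaf M) {g : X → ℍ[ℝ]} {W : Opens X}
    (h : ∀ x ∈ W, ∃ U : Opens X, x ∈ U ∧ U ≤ W ∧ HypermeromorphicOn M g U) :
    HypermeromorphicOn M g W := by
  refine ⟨fun x hx => ?_, fun e he => hM.prop.isLocal _ _ fun q hq => ?_⟩
  · obtain ⟨U, hxU, _, hg⟩ := h x hx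
    exact (hg.1.continuousAt (U.isOpen.mem_nhds hxU)).continuousWithinAt
  · obtain ⟨U, hxU, hUW, hg⟩ := h _ hq.2
    exact ⟨chartImage e U, ⟨hq.1, hxU⟩, chartImage_mono e hUW, hg.2 e he⟩

/-- A hypermeromorphic function that is bounded near an isolated singularity extends, in a chart,
to a hyperholomorphic function. -/
lemma HypermeromorphicOn.exists_chart_extension (hM : IsHypermeromorphicSheaf M) {S : Set X}
    (hS : IsClosed S) {g : X → ℍ[ℝ]} (hg : HypermeromorphicOn M g ⟨Sᶜ, hS.isOpen_compl⟩)
    {h : OpenPartialHomeomorph X ℍ[ℝ]} (hh : h ∈ atlas ℍ[ℝ] X) {s : X} (hs : s ∈ h.source)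
    {K : ℝ} (hb : ∀ᶠ z in 𝓝[≠] s, z ∉ S ∧ ‖g z‖ ≤ K) :
    ∃ (F : ℍ[ℝ] → ℍ[ℝ]) (r : ℝ), 0 < r ∧ ball (h s) r ⊆ h.target ∧
      HyperholomorphicOn F (ball (h s) r) ∧
      ∀ y ∈ ball (h s) r, y ≠ h s → h.symm y ∉ S ∧ F y = g (h.symm y) := by
  have hsymm := (h.continuousAt_symm (h.map_source hs)).tendsto
  rw [h.left_inv hs] at hsymm
  obtain ⟨ρ, hρ, hρt⟩ := Metric.mem_nhds_iff.1
    (inter_mem (h.open_target.mem_nhds (h.map_source hs))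
      (hsymm.eventually (eventually_nhdsWithin_iff.1 hb)))
  have hball : ∀ y ∈ ball (h s) ρ \ {h s}, h.symm y ∉ S ∧ ‖g (h.symm y)‖ ≤ K := by
    rintro y ⟨hy, hys⟩
    refine (hρt hy).2 fun h0 => hys ?_
    have h0 : h.symm y = s := h0
    rw [mem_singleton_iff, ← h0, h.right_inv (hρt hy).1]
  have hgh := (((pseudoholomorphicOn_iff hM).2 hg).2 h hh).2
  obtain ⟨F, r, hr, hF, hFg⟩ := exists_hyperholomorphicOn_extension hρ
    (hgh.mono fun y hy => ⟨(hρt hy.1).1, (hball y hy).1⟩) fun y hy => (hball y hy).2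
  refine ⟨F, min r ρ, lt_min hr hρ, fun y hy => ?_, hF.mono (ball_subset_ball (min_le_left _ _)),
    fun y hy hys => ⟨?_, ?_⟩⟩
  · exact (hρt (ball_subset_ball (min_le_right _ _) hy)).1
  · exact (hball y ⟨ball_subset_ball (min_le_right _ _) hy, hys⟩).1
  · exact hFg y (ball_subset_ball (min_le_left _ _) hy) hys

/-- Riemann's removable singularity theorem for hypermeromorphic functions. -/
theorem HypermeromorphicOn.exists_extension (hM : IsHypermeromorphicSheaf M) {S : Set X}
    (hS : IsClosed S) {g : X → ℍ[ℝ]} (hg : HypermeromorphicOn M g ⟨Sᶜ, hS.isOpen_compl⟩)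
    (hb : ∀ s ∈ S, ∃ K : ℝ, ∀ᶠ z in 𝓝[≠] s, z ∉ S ∧ ‖g z‖ ≤ K) :
    ∃ G : X → ℍ[ℝ], HypermeromorphicOn M G ⊤ ∧ EqOn G g Sᶜ := by
  classical
  -- The values on `S` are defined as limits, without reference to a chart. The extensions obtained
  -- in different charts thus all agree with `G`.
  set G : X → ℍ[ℝ] := fun z => if z ∈ S then limUnder (𝓝[≠] z) g else g z with hGdef
  have hGg : EqOn G g Sᶜ := fun z hz => if_neg hz
  have hloc : ∀ h ∈ atlas ℍ[ℝ] X, ∀ s ∈ h.source, s ∈ S → ∃ (F : ℍ[ℝ] → ℍ[ℝ]) (r : ℝ), 0 < r ∧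
      ball (h s) r ⊆ h.target ∧ HyperholomorphicOn F (ball (h s) r) ∧
      (∀ y ∈ ball (h s) r, y ≠ h s → h.symm y ∉ S) ∧
      EqOn (G ∘ h.symm) F (ball (h s) r) := by
    intro h hh s hs hsS
    obtain ⟨K, hK⟩ := hb s hsS
    obtain ⟨F, r, hr, hrt, hF, hFg⟩ := hg.exists_chart_extension hM hS hh hs hK
    refine ⟨F, r, hr, hrt, hF, fun y hy hys => (hFg y hy hys).1, fun y hy => ?_⟩
    by_cases hys : y = h s
    · have hlim : Tendsto g (𝓝[≠] s) (𝓝 (F (h s))) := by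
        have hFc : ContinuousAt (F ∘ h) s := ContinuousAt.comp
          (hF.1.continuousOn.continuousAt (ball_mem_nhds _ hr)) (h.continuousAt hs)
        refine (hFc.tendsto.mono_left nhdsWithin_le_nhds).congr' ?_
        filter_upwards [self_mem_nhdsWithin, mem_nhdsWithin_of_mem_nhds
          (h.open_source.mem_nhds hs), mem_nhdsWithin_of_mem_nhds
          ((h.continuousAt hs).preimage_mem_nhds (ball_mem_nhds _ hr))] with z hz hzs hzb
        have hne : h z ≠ h s := fun h0 => hz (h.injOn hzs hs h0)
        have := (hFg (h z) hzb hne).2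
        rwa [h.left_inv hzs] at this
      have := nhdsNE_neBot_of_chart h hs
      rw [hys, Function.comp_apply, h.left_inv hs, hGdef]
      simp only [if_pos hsS]
      exact hlim.limUnder_eq
    · rw [Function.comp_apply, hGg (hFg y hy hys).1, (hFg y hy hys).2]
  refine ⟨G, ⟨fun z _ => ?_, fun h hh => hM.prop.isLocal _ _ fun q hq => ?_⟩, hGg⟩
  · refine ContinuousAt.continuousWithinAt ?_
    by_cases hz : z ∈ S
    · obtain ⟨F, r, hr, -, hF, -, hGF⟩ :=
        hloc (chartAt ℍ[ℝ] z) (chart_mem_atlas _ z) z (mem_chart_source _ z) hz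
      have hzs := mem_chart_source ℍ[ℝ] z
      have hFc : ContinuousAt (F ∘ chartAt ℍ[ℝ] z) z := ContinuousAt.comp
        (hF.1.continuousOn.continuousAt (ball_mem_nhds _ hr)) ((chartAt ℍ[ℝ] z).continuousAt hzs)
      refine hFc.congr ?_
      filter_upwards [(chartAt ℍ[ℝ] z).open_source.mem_nhds hzs,
        ((chartAt ℍ[ℝ] z).continuousAt hzs).preimage_mem_nhds (ball_mem_nhds _ hr)] with y hy hyb
      rw [Function.comp_apply, ← hGF hyb, Function.comp_apply, (chartAt ℍ[ℝ] z).left_inv hy]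
    · have hzn := hS.isOpen_compl.mem_nhds hz
      exact (hg.1.continuousAt hzn).congr (hGg.symm.eventuallyEq_of_mem hzn)
  · by_cases hqS : h.symm q ∈ S
    · obtain ⟨F, r, hr, hrt, hF, hrS, hGF⟩ := hloc h hh _ (h.map_target hq.1) hqS
      rw [h.right_inv hq.1] at hrt hF hrS hGF
      -- Hyperholomorphy of `F` does not by itself give membership in `M`. On the punctured ball `G`
      -- is a smooth section because `g` is, and maximality fills the puncture.
      have hV : IsOpen (ball q r \ {q}) := isOpen_ball.sdiff isClosed_singleton
      refine ⟨⟨ball q r, isOpen_ball⟩, mem_ball_self hr, fun y hy => ⟨hrt hy, trivial⟩,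
        hM.mem_of_puncture (V := ⟨_, hV⟩) (a := q) rfl ?_ ?_⟩
      · refine hM.mem_congr (hM.prop.restrict _ _ ?_ _ (hg.2 h hh)) ?_
        · exact fun y hy => ⟨hrt hy.1, hrS y hy.1 hy.2⟩
        · exact fun y hy => hGg (hrS y hy.1 hy.2)
      · exact (hF.1.congr hGF).mono sdiff_subset
    · refine ⟨chartImage h ⟨Sᶜ, hS.isOpen_compl⟩, ⟨hq.1, hqS⟩, chartImage_mono h le_top,
        hM.mem_congr (hg.2 h hh) fun y hy => hGg hy.2⟩

end Manifold

/-! ### Elementary symmetric functions on ramified coverings -/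

section Covering

variable {M : Opens ℍ[ℝ] → Subring (ℍ[ℝ] → ℍ[ℝ])}
variable {X Y : Type*} [TopologicalSpace X] [TopologicalSpace Y] {n : ℕ}

/-- The values of `f` on the sheets over `x`. -/
def sheetValues (f : Y → ℍ[ℝ]) (e : Fin n → OpenPartialHomeomorph Y X) (x : X) : List ℍ[ℝ] :=
  List.ofFn fun j => f ((e j).symm x)

lemma rootProd_sheetValues (f : Y → ℍ[ℝ]) (e : Fin n → OpenPartialHomeomorph Y X) (x : X) :
    rootProd (sheetValues f e x) =
      (List.ofFn fun j => (Polynomial.X - Polynomial.C (f ((e j).symm x)) : Polynomial ℍ[ℝ])).prod := by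
  rw [rootProd, sheetValues, List.map_ofFn]
  rfl

variable [ChartedSpace ℍ[ℝ] X] [ChartedSpace ℍ[ℝ] Y] {p : Y → X}

lemma AreSheets.apply_symm {U : Opens X} {e : Fin n → OpenPartialHomeomorph Y X}
    (he : AreSheets M p U e) (j : Fin n) {x : X} (hx : x ∈ U) : p ((e j).symm x) = x := by
  have hxt : x ∈ (e j).target := by rw [he.target_eq j]; exact hx
  rw [← he.eqOn j ((e j).map_target hxt), (e j).right_inv hxt]

lemma AreSheets.exists_symm_eq {U : Opens X} {e : Fin n → OpenPartialHomeomorph Y X}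
    (he : AreSheets M p U e) {y : Y} (hy : p y ∈ U) : ∃ j, (e j).symm (p y) = y := by
  have h : y ∈ ⋃ j, (e j).source := by rw [he.iUnion_eq]; exact hy
  obtain ⟨j, hj⟩ := mem_iUnion.1 h
  exact ⟨j, by rw [← he.eqOn j hj, (e j).left_inv hj]⟩

variable {A : Set X} {hA : IsClosed A} {B : Set Y} {hB : IsClosed B} {f : Y → ℍ[ℝ]}
  {c : Fin n → X → ℍ[ℝ]}

/-- Over an evenly covered `U`, each `f_i` is hypermeromorphic because the sheets are
bi-pseudoholomorphic and the two classes of functions coincide; the `c_j` are coefficients built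
from the `f_i` in the ring of hypermeromorphic functions. -/
lemma IsElementarySymmetric.hypermeromorphicOn (hM : IsHypermeromorphicSheaf M)
    (hBA : B = p ⁻¹' A) (hc : IsElementarySymmetric M p f c ⟨Aᶜ, hA.isOpen_compl⟩)
    (hf : HypermeromorphicOn M f ⟨Bᶜ, hB.isOpen_compl⟩) (j : Fin n) :
    HypermeromorphicOn M (c j) ⟨Aᶜ, hA.isOpen_compl⟩ := by
  refine hypermeromorphicOn_of_locally hM fun x₀ hx₀ => ?_
  obtain ⟨U, e, hxU, hUA, he, hpoly⟩ := hc x₀ hx₀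
  refine ⟨U, hxU, hUA, ?_⟩
  have hfi : ∀ i, HypermeromorphicOn M (f ∘ (e i).symm) U := by
    intro i
    have h := (he.biPseudoholomorphic i).2 _ f ((pseudoholomorphicOn_iff hM).2 hf)
    rw [pseudoholomorphicOn_iff hM] at h
    convert h using 1
    ext x
    refine ⟨fun hx => ⟨by rw [he.target_eq i]; exact hx, fun hxB => ?_⟩, fun hx => ?_⟩
    · rw [hBA] at hxB
      have hxA : p ((e i).symm x) ∈ A := hxB
      rw [he.apply_symm i hx] at hxA
      exact hUA hx hxA
    · have := hx.1
      rwa [he.target_eq i] at this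
  have hmem := coeff_rootProd_mem (hypermeromorphicSubring M U)
    (List.ofFn fun i => f ∘ (e i).symm) (by
      intro g hg
      obtain ⟨i, rfl⟩ := (List.mem_ofFn' _ _).1 hg
      exact hfi i) (n - 1 - j)
  refine HypermeromorphicOn.congr hM hmem fun x hx => ?_
  have h := hpoly x hx
  rw [← rootProd_sheetValues] at h
  rw [coeff_eq_of_eq_sum h j, sheetValues, List.map_ofFn]
  rfl

lemma IsElementarySymmetric.exists_extension (hM : IsHypermeromorphicSheaf M)
    (hp : IsRamifiedCovering M p n) (hAd : IsDiscrete A) (hBA : B = p ⁻¹' A)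
    (hc : IsElementarySymmetric M p f c ⟨Aᶜ, hA.isOpen_compl⟩)
    (hf : HypermeromorphicOn M f ⟨Bᶜ, hB.isOpen_compl⟩) {F : Y → ℍ[ℝ]}
    (hF : HypermeromorphicOn M F ⊤) (hFf : EqOn F f Bᶜ) (j : Fin n) :
    ∃ C : X → ℍ[ℝ], HypermeromorphicOn M C ⊤ ∧ EqOn C (c j) Aᶜ := by
  refine (hc.hypermeromorphicOn (hA := hA) (hB := hB) hM hBA hf j).exists_extension hM hA fun a ha => ?_
  have hFc : Continuous F := continuousOn_univ.1 hF.1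
  obtain ⟨K, hK⟩ := ((hp.finite_fiber a).image fun y => ‖F y‖).bddAbove
  -- `V` is an open neighbourhood of the fibre over `a`. As `p` is closed, `V` contains the preimage
  -- of a neighbourhood of `a`, so `F` is bounded on all sheets there. Taking `max K 0` covers an
  -- empty fibre, where `K` could be negative.
  set V : Set Y := {y | ‖F y‖ < max K 0 + 1}
  have hV : IsOpen V := isOpen_lt hFc.norm continuous_const
  have hO : IsOpen (p '' Vᶜ)ᶜ := (hp.isProperMap.isClosedMap _ hV.isClosed_compl).isOpen_compl
  have haO : a ∈ (p '' Vᶜ)ᶜ := by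
    rintro ⟨y, hyV, hya⟩
    refine hyV ?_
    have h1 : ‖F y‖ ≤ K := hK ⟨y, hya, rfl⟩
    exact lt_of_le_of_lt (h1.trans (le_max_left _ _)) (lt_add_one _)
  refine ⟨(max K 0 + 1 + 1) ^ n, ?_⟩
  filter_upwards [eventually_nhdsNE_notMem_of_isDiscrete hAd ha,
    mem_nhdsWithin_of_mem_nhds (hO.mem_nhds haO)] with x hxA hxO
  refine ⟨hxA, ?_⟩
  obtain ⟨U, e, hxU, hUA, he, hpoly⟩ := hc x hxA
  have h := hpoly x hxU
  rw [← rootProd_sheetValues] at h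
  have hlen : (sheetValues f e x).length = n := by simp [sheetValues]
  rw [coeff_eq_of_eq_sum h j]
  refine (norm_coeff_rootProd_le (K := max K 0 + 1) (by positivity) _ (fun g hg => ?_) _).trans_eq
    (by rw [hlen])
  obtain ⟨i, rfl⟩ := (List.mem_ofFn' _ _).1 hg
  have hpx := he.apply_symm i hxU
  have hyB : (e i).symm x ∈ Bᶜ := fun h' => hxA (by
    rw [hBA] at h'
    rw [← hpx]
    exact h')
  change ‖f ((e i).symm x)‖ ≤ _
  rw [← hFf hyB]
  by_contra hlt
  exact hxO ⟨_, fun h' => hlt (le_of_lt h'), hpx⟩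

lemma IsElementarySymmetric.exists_extension_of_coeff [T1Space Y] (hM : IsHypermeromorphicSheaf M)
    (hp : IsRamifiedCovering M p n) (hAd : IsDiscrete A) (hBA : B = p ⁻¹' A)
    (hc : IsElementarySymmetric M p f c ⟨Aᶜ, hA.isOpen_compl⟩)
    (hf : HypermeromorphicOn M f ⟨Bᶜ, hB.isOpen_compl⟩)
    (hC : ∀ j, ∃ C : X → ℍ[ℝ], HypermeromorphicOn M C ⊤ ∧ EqOn C (c j) Aᶜ) :
    ∃ F : Y → ℍ[ℝ], HypermeromorphicOn M F ⊤ ∧ EqOn F f Bᶜ := by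
  choose C hC hCc using hC
  refine hf.exists_extension hM hB fun b hb => ?_
  have hpc : Continuous p := hp.isProperMap.continuous
  have ha : p b ∈ A := by rw [hBA] at hb; exact hb
  have hCcont : ∀ j, Continuous (C j) := fun j => continuousOn_univ.1 (hC j).1
  -- The summand `1` accounts for the leading coefficient; each `‖C j‖` exceeds its value at `p b`
  -- by less than `1` near that point.
  obtain ⟨K', hK'⟩ := exists_forall_norm_le_of_norm_coeff_rootProd_le n
    (K := 1 + ∑ j, (‖C j (p b)‖ + 1)) (by positivity)
  have hbound : ∀ᶠ y in 𝓝 b, ∀ j, ‖C j (p y)‖ < ‖C j (p b)‖ + 1 := by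
    refine eventually_all.2 fun j => ?_
    exact ((hCcont j).comp hpc).norm.continuousAt.eventually_lt continuousAt_const
      (lt_add_one _)
  have hA' : ∀ᶠ y in 𝓝 b, p y ≠ p b → p y ∉ A :=
    hpc.continuousAt.tendsto.eventually
      (eventually_nhdsWithin_iff.1 (eventually_nhdsNE_notMem_of_isDiscrete hAd ha))
  -- Finiteness of the fibre isolates `b` in it. Nearby points other than `b` therefore map to
  -- points other than `p b`, and these avoid `A` by discreteness.
  have hfib : ∀ᶠ y in 𝓝 b, y ∉ p ⁻¹' {p b} \ {b} :=
    ((hp.finite_fiber (p b)).subset sdiff_subset).isClosed.isOpen_compl.mem_nhds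
      fun h => h.2 rfl
  refine ⟨K', ?_⟩
  filter_upwards [self_mem_nhdsWithin, mem_nhdsWithin_of_mem_nhds hbound,
    mem_nhdsWithin_of_mem_nhds hA', mem_nhdsWithin_of_mem_nhds hfib] with y hyb hy hyA hyf
  have hpyA : p y ∉ A := hyA fun h => hyf ⟨h, hyb⟩
  refine ⟨fun hyB => hpyA (by rw [hBA] at hyB; exact hyB), ?_⟩
  obtain ⟨U, e, hxU, -, he, hpoly⟩ := hc (p y) hpyA
  obtain ⟨i, hi⟩ := he.exists_symm_eq hxU
  have h := hpoly (p y) hxU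
  rw [← rootProd_sheetValues] at h
  refine hK' (sheetValues f e (p y)) (by simp [sheetValues]) (fun k => ?_) (f y) ?_
  · refine (norm_coeff_le_of_eq_sum h k).trans ?_
    gcongr with j
    rw [← hCc j hpyA]
    exact (hy j).le
  · exact (List.mem_ofFn' _ _).2 ⟨i, by simp only [hi]⟩

end Covering

end Hyper

theorem theorem6p5
    (M : Opens ℍ[ℝ] → Subring (ℍ[ℝ] → ℍ[ℝ])) (hM : Hyper.IsHypermeromorphicSheaf M)
    {X Y : Type*} [TopologicalSpace X] [T2Space X] [ChartedSpace ℍ[ℝ] X]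
    [TopologicalSpace Y] [T2Space Y] [ChartedSpace ℍ[ℝ] Y]
    (n : ℕ) (p : Y → X) (hp : Hyper.IsRamifiedCovering M p n)
    (A : Set X) (hA : IsClosed A) (hAd : IsDiscrete A) (hAc : Hyper.criticalValues M p n ⊆ A)
    (B : Set Y) (hB : IsClosed B) (hBA : B = p ⁻¹' A)
    (f : Y → ℍ[ℝ]) (c : Fin n → X → ℍ[ℝ])
    (hc : Hyper.IsElementarySymmetric M p f c ⟨Aᶜ, hA.isOpen_compl⟩) :
    (Hyper.PseudoholomorphicOn M f ⟨Bᶜ, hB.isOpen_compl⟩ →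
      (∀ j, Hyper.PseudoholomorphicOn M (c j) ⟨Aᶜ, hA.isOpen_compl⟩) ∧
      ((∃ F : Y → ℍ[ℝ], Hyper.PseudoholomorphicOn M F ⊤ ∧ EqOn F f Bᶜ) ↔
        ∀ j, ∃ C : X → ℍ[ℝ], Hyper.PseudoholomorphicOn M C ⊤ ∧ EqOn C (c j) Aᶜ)) ∧
    (Hyper.HypermeromorphicOn M f ⟨Bᶜ, hB.isOpen_compl⟩ →
      (∀ j, Hyper.HypermeromorphicOn M (c j) ⟨Aᶜ, hA.isOpen_compl⟩) ∧
      ((∃ F : Y → ℍ[ℝ], Hyper.HypermeromorphicOn M F ⊤ ∧ EqOn F f Bᶜ) ↔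
        ∀ j, ∃ C : X → ℍ[ℝ], Hyper.HypermeromorphicOn M C ⊤ ∧ EqOn C (c j) Aᶜ)) := by
  -- Once the two classes are identified, both halves become the same goal.
  simp_rw [Hyper.pseudoholomorphicOn_iff hM]
  refine ⟨?_, ?_⟩ <;>
  · intro hf
    refine ⟨hc.hypermeromorphicOn (hA := hA) (hB := hB) hM hBA hf, ?_, ?_⟩
    · rintro ⟨F, hF, hFf⟩ j
      exact hc.exists_extension (hA := hA) (hB := hB) hM hp hAd hBA hf hF hFf j
    · exact hc.exists_extension_of_coeff (hA := hA) (hB := hB) hM hp hAd hBA hf
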